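/- Let $T>0$, $0\le l\le r$, $s,k\ge 0$, and consider the problem of minimizing $\ell_0(x(0),x(T))$ subject to $\dot x=f(t,x,u)$, $u\in U(t)\subset\mathbb R^m$, $g_i(t,x(t))\le 0$ on $[0,T]$ ($i=1,\dots,s$), $\ell_j(x(0),x(T))\le 0$ ($j=1,\dots,l$), $\ell_j(x(0),x(T))=0$ ($j=l+1,\dots,r$), where $x\in W^{1,1}=W^{1,1}([0,T],\mathbb R^n)$ (absolutely continuous, $\|x\|_{1,1}=\|x(0)\|+\|\dot x\|_1$) and $u$ is measurable. Let $(\bar x,\bar u)\in W^{1,1}\times L^\infty$ be a feasible control process. Assume that for some $\rho>0$ the function $t\mapsto f(t,x(t),u(t))$ is measurable for all $x\in W^{1,1}$ with $\sup_t\|x(t)-\bar x(t)\|<\rho$ and all measurable selections $u$ of $U$ (that is, $u(t)\in U(t)$ a.e.; this holds e.g. if $f$ is Lebesgue$\times$Borel measurable), and that: (H$_9$) each $\ell_j$, $0\le j\le r$, is $C^1$ near $(\bar x(0),\bar x(T))$ and has a second derivative at that point. (H$_{10}$) The functions $f(t,\bar x(t),\bar u(t))$ and $f'_{(x,u)}(t,\bar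 x(t),\bar u(t))$ are summable on $[0,T]$. For some $\delta_1>0$ and a.e. $t$: $f(t,\cdot,\cdot)$ is continuous on $B(\bar x(t),\delta_1)\times U(t)$ together with its derivative $f'_x$, and continuously differentiable in $(x,u)$ at the points of $B(\bar x(t),\delta_1)\times(B(\bar u(t),\delta_1)\cap U(t))$. For every $K>0$ the functions $\sup\{\|f(t,\bar x(t),u)\|:u\in U(t),\|u\|\le K\}$ and $\sup\{\|f'_x(t,\bar x(t),u)\|:u\in U(t),\|u\|\le K\}$ are dominated by summable functions. There is a summable $\bar f''(t)$ with values in the bilinear maps $(\mathbb R^n\times\mathbb R^m)^2\to\mathbb R^n$ such that for every $h\in W^{1,1}$ and $v\in L^\infty$ the function $r_a(t)=f(t,\bar x+ah,\bar u+av)-f(t,\bar x,\bar u)-af'_{(x,u)}(t,\bar x,\bar u)(h,v)-\frac{a^2}{2}\bar f''(t)((h,v),(h,v))$ (with $\bar x,\bar u,h,v$ taken at $t$) satisfies $\int_0^T\|r_a(t)\|dt=o(a^2)$ as $a\downarrow 0$. (H$_{11}$) $g_i$ and $g'_{ix}$ are continuous on $[0,T]\times\mathbb R^n$, and $g''_{ix}(t,\bar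 x(t))$ exists and is continuous on $[0,T]$. Let $\mathcal U$ be the set of measurable selections $u$ of $U$ for which there are $\gamma>0$ and a summable $\kappa$ such that for a.e. $t$: $\|f(t,\bar x(t),u(t))\|\le\kappa(t)$ and $\|f(t,x,u(t))-f(t,x',u(t))\|\le\kappa(t)\|x-x'\|$ for $x,x'\in B(\bar x(t),\gamma)$. Let $u_1,\dots,u_k\in\mathcal U$, $\lambda>0$, $\delta>0$. Put $$\psi(x)=\max\Big\{\ell_0(x(0),x(T))-\ell_0(\bar x(0),\bar x(T)),\ \max_{1\le j\le l}\ell_j(x(0),x(T)),\ \max_{1\le i\le s}\max_{0\le t\le T}g_i(t,x(t))\Big\},$$ $$\mathcal J_k(x,u,\alpha)=\lambda\psi(x)+\sum_{j=l+1}^r|\ell_j(x(0),x(T))|+\int_0^T\Big\|\dot x-f(t,x,u)-\sum_{i=1}^k\alpha_i\big(f(t,x,u_i)-f(t,x,u)\big)\Big\|dt ,$$ the latter on the set $Z_k$ of all $(x,u,\alpha_1,\dots,\alpha_k)$ with $x\in W^{1,1}$, $u$ measurable, $u(t)\in (B(\bar u(t),\delta)\cap U(t))\cup\{u_1(t),\dots,u_k(t)\}$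 a.e., $\alpha_i\ge 0$, $\sum\alpha_i\le 1$ (the integral may be $+\infty$). Let $H(t,x,p,u)=\langle p,f(t,x,u)\rangle$ and $\Delta_i=\{t\in[0,T]:g_i(t,\bar x(t))=0\}$. Assume that $(\bar x,\bar u,0,\dots,0)$ is a local minimum of $\mathcal J_k$ on $Z_k$ in the topology of $W^{1,1}\times L^\infty\times\mathbb R^k$. Then there are real numbers $\lambda_0,\dots,\lambda_r$, finite nonnegative Borel measures $\mu_1,\dots,\mu_s$ with $\mu_i$ supported on $\Delta_i$, and a function $p:[0,T]\to\mathbb R^n$ of bounded variation such that $\lambda_j\ge 0$ for $0\le j\le l$, $\lambda_j\ell_j(\bar x(0),\bar x(T))=0$ for $1\le j\le l$, $$\lambda_0+\dots+\lambda_l+|\lambda_{l+1}|+\dots+|\lambda_r|+\mu_1([0,T])+\dots+\mu_s([0,T])>0,$$ $$\int_0^T\langle p(t),f(t,\bar x(t),\bar u(t))-f(t,\bar x(t),u_i(t))\rangle dt\ge 0,\qquad i=1,\dots,k,\tag{24}$$ $p(T)=\lim_{t\uparrow T}p(t)$, for every $t\in[0,T]$ $$p(t)+\sum_{i=1}^s\int_{[t,T]}g'_{ix}(\tau,\bar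 x(\tau))\,\mu_i(d\tau)-\int_t^TH'_x(\tau,\bar x(\tau),p(\tau),\bar u(\tau))\,d\tau=p(T)+\sum_{i=1}^sg'_{ix}(T,\bar x(T))\mu_i(\{T\}),\tag{25}$$ and $$\Big(p(0),-\Big(p(T)+\sum_{i=1}^sg'_{ix}(T,\bar x(T))\mu_i(\{T\})\Big)\Big)=\sum_{j=0}^r\lambda_j\ell'_j(\bar x(0),\bar x(T)).\tag{26}$$ -/

import Mathlib

set_option maxSynthPendingDepth 3

open MeasureTheory Set Filter Topology
open scoped ENNReal

noncomputable section

/-- Euclidean space `ℝⁿ`. -/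
abbrev Euc (n : ℕ) : Type := EuclideanSpace ℝ (Fin n)

/-- Data of the optimal control problem: minimize `ℓ₀(x(0),x(T))` subject to
`ẋ = f(t,x,u)`, `u ∈ U(t)`, `g_i(t,x(t)) ≤ 0` (`s` state constraints),
`ℓ_j(x(0),x(T)) ≤ 0` for `1 ≤ j ≤ l` and `ℓ_j(x(0),x(T)) = 0` for `l < j ≤ r`. -/
structure ControlProblem (n m l r s : ℕ) where
  T : ℝ
  T_pos : 0 < T
  l_le : l ≤ r
  f : ℝ → Euc n → Euc m → Euc n
  U : ℝ → Set (Euc m)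
  g : Fin s → ℝ → Euc n → ℝ
  ell : Fin (r + 1) → Euc n × Euc n → ℝ

namespace ControlProblem

variable {n m l r s : ℕ} (P : ControlProblem n m l r s)

/-- Lebesgue measure on `[0,T]`. -/
abbrev leb : Measure ℝ := volume.restrict (Icc 0 P.T)

/-- `x ∈ W^{1,1}([0,T], ℝⁿ)`: absolutely continuous on `[0,T]`. -/
def IsArc (x : ℝ → Euc n) : Prop := AbsolutelyContinuousOnInterval x 0 P.T

/-- The pair of end points `(x(0), x(T))`. -/
def ends (x : ℝ → Euc n) : Euc n × Euc n := (x 0, x P.T)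

/-- Measurable selections of `U(·)` on `[0,T]`. -/
def IsSelection (u : ℝ → Euc m) : Prop :=
  AEStronglyMeasurable u P.leb ∧ ∀ᵐ t ∂P.leb, u t ∈ P.U t

/-- `(x,u) ∈ W^{1,1} × L^∞` is a feasible control process. -/
structure IsFeasible (x : ℝ → Euc n) (u : ℝ → Euc m) : Prop where
  arc : P.IsArc x
  bounded : MemLp u ∞ P.leb
  selection : P.IsSelection u
  dynamics : ∀ᵐ t ∂P.leb, deriv x t = P.f t (x t) (u t)
  state : ∀ i, ∀ t ∈ Icc 0 P.T, P.g i t (x t) ≤ 0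
  endpoint_le : ∀ j : Fin (r + 1), 1 ≤ j.val → j.val ≤ l → P.ell j (P.ends x) ≤ 0
  endpoint_eq : ∀ j : Fin (r + 1), l < j.val → P.ell j (P.ends x) = 0

/-- Superposition measurability near `xb`, so that the integral in the reduced functional makes
sense; it holds for instance if `f` is (Lebesgue × Borel)-measurable. -/
def SuperpositionMeasurable (xb : ℝ → Euc n) : Prop :=
  ∃ δ > 0, ∀ x : ℝ → Euc n, P.IsArc x → (∀ t ∈ Icc 0 P.T, ‖x t - xb t‖ < δ) →
    ∀ u : ℝ → Euc m, P.IsSelection u →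
      AEStronglyMeasurable (fun t => P.f t (x t) (u t)) P.leb

/-- The class `𝒰` of measurable selections `u` of `U` along which `f(t,·,u(t))` is bounded at `xb(t)`
and Lipschitz near `xb(t)`, with a summable bound and a summable Lipschitz constant. -/
def GoodControl (xb : ℝ → Euc n) (u : ℝ → Euc m) : Prop :=
  P.IsSelection u ∧ ∃ γ > 0, ∃ κ : ℝ → ℝ, Integrable κ P.leb ∧
    ∀ᵐ t ∂P.leb, ‖P.f t (xb t) (u t)‖ ≤ κ t ∧
      ∀ x ∈ Metric.ball (xb t) γ, ∀ x' ∈ Metric.ball (xb t) γ,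
        ‖P.f t x (u t) - P.f t x' (u t)‖ ≤ κ t * ‖x - x'‖

/-- Assumption on the end point functions: each `ℓ_j` is `C¹` near the end points of `xb` and has a
second derivative there. -/
def EndpointRegular (xb : ℝ → Euc n) : Prop :=
  ∀ j, ContDiffAt ℝ 1 (P.ell j) (P.ends xb) ∧
    DifferentiableAt ℝ (fderiv ℝ (P.ell j)) (P.ends xb)

/-- `f(t,·,·)` as a function of the pair `(x,u)`. -/
def fpair (t : ℝ) (z : Euc n × Euc m) : Euc n := P.f t z.1 z.2

/-- `f'_x(t,x,u)`. -/
def fx (t : ℝ) (x : Euc n) (u : Euc m) : Euc n →L[ℝ] Euc n := fderiv ℝ (fun y => P.f t y u) x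

/-- The remainder of the second order expansion of `f(t,·,·)` at `(x,u)`, in the
direction `(h,v)`, with step `a`, and with the second derivative `D`. -/
def remainder (D : Euc n × Euc m →L[ℝ] Euc n × Euc m →L[ℝ] Euc n)
    (t : ℝ) (x : Euc n) (u : Euc m) (a : ℝ) (h : Euc n) (v : Euc m) : Euc n :=
  P.f t (x + a • h) (u + a • v) - P.f t x u - a • fderiv ℝ (P.fpair t) (x, u) (h, v)
    - (a ^ 2 / 2) • D (h, v) (h, v)

/-- Assumption on the dynamics. -/
structure DynamicsRegular (xb : ℝ → Euc n) (ub : ℝ → Euc m) : Prop where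
  summable_f : Integrable (fun t => P.f t (xb t) (ub t)) P.leb
  summable_deriv : Integrable (fun t => fderiv ℝ (P.fpair t) (xb t, ub t)) P.leb
  /-- continuity of `f` and of `f'_x`, and continuous differentiability of `f` in `(x,u)` -/
  regular : ∃ δ > 0, ∀ᵐ t ∂P.leb,
    ContinuousOn (P.fpair t) (Metric.ball (xb t) δ ×ˢ P.U t) ∧
    (∀ x ∈ Metric.ball (xb t) δ, ∀ u ∈ P.U t, DifferentiableAt ℝ (fun y => P.f t y u) x) ∧
    ContinuousOn (fun z : Euc n × Euc m => P.fx t z.1 z.2) (Metric.ball (xb t) δ ×ˢ P.U t) ∧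
    (∀ z ∈ Metric.ball (xb t) δ ×ˢ (Metric.ball (ub t) δ ∩ P.U t),
      DifferentiableAt ℝ (P.fpair t) z) ∧
    ContinuousOn (fderiv ℝ (P.fpair t)) (Metric.ball (xb t) δ ×ˢ (Metric.ball (ub t) δ ∩ P.U t))
  /-- the suprema of `‖f(t,xb(t),u)‖` and of `‖f'_x(t,xb(t),u)‖` over the `u ∈ U(t)` with `‖u‖ ≤ K`
  are dominated by summable functions -/
  dominated : ∀ K > 0, ∃ κ : ℝ → ℝ, Integrable κ P.leb ∧
    ∀ᵐ t ∂P.leb, ∀ u ∈ P.U t, ‖u‖ ≤ K → ‖P.f t (xb t) u‖ ≤ κ t ∧ ‖P.fx t (xb t) u‖ ≤ κ t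
  /-- second order differentiability at `(xb(t),ub(t))`, with a summable second derivative and an
  integral remainder of order `o(a²)` along every `(h,v) ∈ W^{1,1} × L^∞` -/
  second_order : ∃ D : ℝ → (Euc n × Euc m →L[ℝ] Euc n × Euc m →L[ℝ] Euc n),
    Integrable D P.leb ∧
    ∀ h : ℝ → Euc n, P.IsArc h → ∀ v : ℝ → Euc m, MemLp v ∞ P.leb →
      ∀ ε > 0, ∃ a₀ > 0, ∀ a ∈ Ioo (0 : ℝ) a₀,
        ∫⁻ t, ‖P.remainder (D t) t (xb t) (ub t) a (h t) (v t)‖ₑ ∂P.leb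
          ≤ ENNReal.ofReal (ε * a ^ 2)

/-- Assumption on the state constraints. -/
structure StateRegular (xb : ℝ → Euc n) : Prop where
  cont : ∀ i, ContinuousOn (fun z : ℝ × Euc n => P.g i z.1 z.2) (Icc 0 P.T ×ˢ univ)
  diff : ∀ i, ∀ t ∈ Icc 0 P.T, Differentiable ℝ (P.g i t)
  cont_deriv : ∀ i,
    ContinuousOn (fun z : ℝ × Euc n => fderiv ℝ (P.g i z.1) z.2) (Icc 0 P.T ×ˢ univ)
  diff_two : ∀ i, ∀ t ∈ Icc 0 P.T, DifferentiableAt ℝ (fderiv ℝ (P.g i t)) (xb t)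
  cont_two : ∀ i, ContinuousOn (fun t => fderiv ℝ (fderiv ℝ (P.g i t)) (xb t)) (Icc 0 P.T)

/-- `ψ(x)`, the maximum of `ℓ₀(x(0),x(T)) - ℓ₀(xb(0),xb(T))`, of the `ℓ_j(x(0),x(T))` with
`1 ≤ j ≤ l`, and of the `g_i(t,x(t))` with `t ∈ [0,T]`. -/
def psi (xb x : ℝ → Euc n) : ℝ :=
  sSup ({P.ell 0 (P.ends x) - P.ell 0 (P.ends xb)}
    ∪ {y | ∃ j : Fin (r + 1), 1 ≤ j.val ∧ j.val ≤ l ∧ y = P.ell j (P.ends x)}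
    ∪ {y | ∃ i, ∃ t ∈ Icc 0 P.T, y = P.g i t (x t)})

/-- The reduced functional `𝒥_k` with coefficient `c > 0` of `ψ` (extended-valued, as the integral
of a nonnegative function may be infinite). -/
def reduced {k : ℕ} (c : ℝ) (xb : ℝ → Euc n) (w : Fin k → ℝ → Euc m)
    (x : ℝ → Euc n) (u : ℝ → Euc m) (α : Fin k → ℝ) : EReal :=
  ((c * P.psi xb x + ∑ j : Fin (r + 1) with l < j.val, |P.ell j (P.ends x)| : ℝ) : EReal)
    + ((∫⁻ t, ‖deriv x t - P.f t (x t) (u t)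
        - ∑ i, α i • (P.f t (x t) (w i t) - P.f t (x t) (u t))‖ₑ ∂P.leb : ℝ≥0∞) : EReal)

/-- The domain `Z_k` of the reduced functional: `x ∈ W^{1,1}`, `u` measurable with values in
`U_k(t) = (B(ub(t),δ) ∩ U(t)) ∪ {w₁(t),…,w_k(t)}`, `α_i ≥ 0` and `∑ α_i ≤ 1`. -/
structure InZ {k : ℕ} (δ : ℝ) (ub : ℝ → Euc m) (w : Fin k → ℝ → Euc m)
    (x : ℝ → Euc n) (u : ℝ → Euc m) (α : Fin k → ℝ) : Prop where
  arc : P.IsArc x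
  meas : AEStronglyMeasurable u P.leb
  mem : ∀ᵐ t ∂P.leb, u t ∈ (Metric.closedBall (ub t) δ ∩ P.U t) ∪ {v | ∃ i, v = w i t}
  nonneg : ∀ i, 0 ≤ α i
  sum_le : ∑ i, α i ≤ 1

/-- `(xb,ub,0,…,0)` is a local minimum of the reduced functional on `Z_k` in the topology of
`W^{1,1} × L^∞ × ℝᵏ`, where `‖x‖_{1,1} = ‖x(0)‖ + ‖ẋ‖_1`. -/
def IsLocalMinReduced {k : ℕ} (c δ : ℝ) (xb : ℝ → Euc n) (ub : ℝ → Euc m)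
    (w : Fin k → ℝ → Euc m) : Prop :=
  P.InZ δ ub w xb ub 0 ∧
  ∃ η > 0, ∀ (x : ℝ → Euc n) (u : ℝ → Euc m) (α : Fin k → ℝ), P.InZ δ ub w x u α →
    ‖x 0 - xb 0‖ₑ + eLpNorm (fun t => deriv x t - deriv xb t) 1 P.leb < ENNReal.ofReal η →
    eLpNorm (fun t => u t - ub t) ∞ P.leb < ENNReal.ofReal η →
    (∀ i, |α i| < η) →
    P.reduced c xb w xb ub 0 ≤ P.reduced c xb w x u α

/-- `Δ_i = {t ∈ [0,T] : g_i(t,xb(t)) = 0}`. -/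
def active (xb : ℝ → Euc n) (i : Fin s) : Set ℝ := {t | t ∈ Icc 0 P.T ∧ P.g i t (xb t) = 0}

/-- `g'_{ix}(t,x)` as a vector of `ℝⁿ`. -/
def gx (i : Fin s) (t : ℝ) (x : Euc n) : Euc n := gradient (P.g i t) x

/-- The Hamiltonian `H(t,x,p,u) = ⟨p, f(t,x,u)⟩`. -/
def ham (t : ℝ) (x p : Euc n) (u : Euc m) : ℝ := inner ℝ p (P.f t x u)

/-- `H'_x(t,x,p,u)` as a vector of `ℝⁿ`. -/
def hamx (t : ℝ) (x p : Euc n) (u : Euc m) : Euc n := gradient (fun y => P.ham t y p u) x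

/-- `(λ₀,…,λ_r, μ₁,…,μ_s, p)` belongs to the set `Λ_k` of multipliers. -/
structure IsMultiplier {k : ℕ} (xb : ℝ → Euc n) (ub : ℝ → Euc m) (w : Fin k → ℝ → Euc m)
    (lam : Fin (r + 1) → ℝ) (μ : Fin s → Measure ℝ) (p : ℝ → Euc n) : Prop where
  finite : ∀ i, IsFiniteMeasure (μ i)
  supported : ∀ i, μ i (P.active xb i)ᶜ = 0
  bv : BoundedVariationOn p (Icc 0 P.T)
  nonneg : ∀ j, j.val ≤ l → 0 ≤ lam j
  slack : ∀ j, 1 ≤ j.val → j.val ≤ l → lam j * P.ell j (P.ends xb) = 0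
  nontrivial : 0 < ∑ j : Fin (r + 1) with j.val ≤ l, lam j
    + ∑ j : Fin (r + 1) with l < j.val, |lam j| + ∑ i, (μ i).real (Icc 0 P.T)
  /-- the integral inequalities -/
  integral_ineq : ∀ i, 0 ≤ ∫ t, inner ℝ (p t) (P.f t (xb t) (ub t) - P.f t (xb t) (w i t)) ∂P.leb
  /-- `p(T)` is the limit of `p(t)` as `t → T` -/
  left_limit : Tendsto p (𝓝[<] P.T) (𝓝 (p P.T))
  /-- the adjoint relation; `∫_t^T … dμ_i` is taken over the closed interval `[t,T]` -/
  adjoint : ∀ t ∈ Icc 0 P.T,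
    p t + ∑ i, ∫ τ in Icc t P.T, P.gx i τ (xb τ) ∂(μ i)
        - ∫ τ in Icc t P.T, P.hamx τ (xb τ) (p τ) (ub τ)
      = p P.T + ∑ i, (μ i).real {P.T} • P.gx i P.T (xb P.T)
  /-- the transversality relation
  `(p(0), -(p(T) + ∑ g'_{ix}(T,xb(T)) μ_i({T}))) = ∑ λ_j ℓ'_j(xb(0),xb(T))` -/
  transversality : ∀ h₀ h₁ : Euc n,
    inner ℝ (p 0) h₀ - inner ℝ (p P.T + ∑ i, (μ i).real {P.T} • P.gx i P.T (xb P.T)) h₁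
      = ∑ j, lam j * fderiv ℝ (P.ell j) (P.ends xb) (h₀, h₁)

end ControlProblem

end

noncomputable section

section LinearODE

variable {E F : Type*} [NormedAddCommGroup E] [NormedSpace ℝ E]
  [NormedAddCommGroup F] [NormedSpace ℝ F]

/-- A summable family of operators applied to a continuous function is summable. -/
theorem IntervalIntegrable.clm_apply_continuousOn {a b : ℝ} {A : ℝ → E →L[ℝ] F}
    (hA : IntervalIntegrable A volume a b) {h : ℝ → E} (hh : ContinuousOn h (uIcc a b)) :
    IntervalIntegrable (fun s => A s (h s)) volume a b := by
  rw [intervalIntegrable_iff] at hA ⊢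
  obtain ⟨C, hC⟩ := isCompact_uIcc.exists_bound_of_continuousOn hh
  have hm : AEStronglyMeasurable h (volume.restrict (uIoc a b)) :=
    (hh.mono uIoc_subset_uIcc).aestronglyMeasurable measurableSet_uIoc
  refine Integrable.mono' (hA.norm.mul_const C)
    (isBoundedBilinearMap_apply.continuous.comp_aestronglyMeasurable
      (hA.aestronglyMeasurable.prodMk hm)) ?_
  filter_upwards [ae_restrict_mem measurableSet_uIoc] with s hs
  exact (A s).le_opNorm_of_le (hC s (uIoc_subset_uIcc hs))

theorem integral_mul_exp_integral_le {a : ℝ → ℝ} {T t : ℝ} (ha : IntervalIntegrable a volume 0 T)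
    (hnn : ∀ s, 0 ≤ a s) (ht : t ∈ Icc 0 T) :
    ∫ s in (0 : ℝ)..t, a s * Real.exp (2 * ∫ r in (0 : ℝ)..s, a r)
      ≤ Real.exp (2 * ∫ r in (0 : ℝ)..t, a r) / 2 := by
  have hat : IntervalIntegrable a volume 0 t := ha.mono_set (by
    rw [uIcc_of_le ht.1, uIcc_of_le (ht.1.trans ht.2)]; exact Icc_subset_Icc_right ht.2)
  set F : ℝ → ℝ := fun s => Real.exp (2 * ∫ r in (0 : ℝ)..s, a r) with hF
  have hmono : MonotoneOn F (uIcc 0 t) := by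
    rw [uIcc_of_le ht.1]
    intro x hx y hy hxy
    have hxi : IntervalIntegrable a volume 0 x := hat.mono_set (by
      rw [uIcc_of_le hx.1, uIcc_of_le ht.1]; exact Icc_subset_Icc_right hx.2)
    have hyi : IntervalIntegrable a volume 0 y := hat.mono_set (by
      rw [uIcc_of_le hy.1, uIcc_of_le ht.1]; exact Icc_subset_Icc_right hy.2)
    have : 0 ≤ (∫ r in (0 : ℝ)..y, a r) - ∫ r in (0 : ℝ)..x, a r := by
      rw [intervalIntegral.integral_interval_sub_left hyi hxi]
      exact intervalIntegral.integral_nonneg hxy fun s _ => hnn s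
    simp only [hF]
    gcongr
    linarith
  have h1 := hmono.intervalIntegral_deriv_mem_uIcc
  have h0 : F 0 ≤ F t := hmono left_mem_uIcc right_mem_uIcc ht.1
  rw [uIcc_of_le (by linarith)] at h1
  have h2 : ∫ s in (0 : ℝ)..t, deriv F s = ∫ s in (0 : ℝ)..t, 2 * (a s * F s) := by
    refine intervalIntegral.integral_congr_ae ?_
    filter_upwards [hat.ae_hasDerivAt_integral] with s hs hs'
    have := ((hs (uIoc_subset_uIcc hs') 0 left_mem_uIcc).const_mul 2).exp
    rw [this.deriv]
    ring
  rw [h2, intervalIntegral.integral_const_mul] at h1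
  have h3 : 0 < F 0 := Real.exp_pos _
  linarith [h1.2]

/-- Linear differential equations with summable coefficients have solutions. -/
theorem exists_linear_ode [CompleteSpace E] {T : ℝ} (hT : 0 ≤ T) {A : ℝ → E →L[ℝ] E}
    (hA : IntervalIntegrable A volume 0 T) {b : ℝ → E} (hb : IntervalIntegrable b volume 0 T)
    (y₀ : E) :
    ∃ h : ℝ → E, ContinuousOn h (Icc 0 T) ∧
      ∀ t ∈ Icc 0 T, h t = y₀ + ∫ s in (0 : ℝ)..t, (A s (h s) + b s) := by
  set L : ℝ → ℝ := fun t => ∫ r in (0 : ℝ)..t, ‖A r‖ with hL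
  have hsub : ∀ {t}, t ∈ Icc 0 T → uIcc 0 t ⊆ uIcc 0 T := fun {t} ht => by
    rw [uIcc_of_le ht.1, uIcc_of_le hT]; exact Icc_subset_Icc_right ht.2
  have hLc : ContinuousOn L (Icc 0 T) := by
    have := intervalIntegral.continuousOn_primitive_interval' hA.norm left_mem_uIcc
    rwa [uIcc_of_le hT] at this
  set ex : C(Icc (0 : ℝ) T, E) → ℝ → E := fun z s => Real.exp (2 * L s) • z (projIcc 0 T hT s)
  have hex : ∀ z, ContinuousOn (ex z) (uIcc 0 T) := fun z => by
    rw [uIcc_of_le hT]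
    exact (Real.continuous_exp.comp_continuousOn (hLc.const_mul 2)).smul
      (z.continuous.comp continuous_projIcc).continuousOn
  have hint : ∀ z, IntervalIntegrable (fun s => A s (ex z s) + b s) volume 0 T := fun z =>
    (hA.clm_apply_continuousOn (hex z)).add hb
  set Φ₀ : C(Icc (0 : ℝ) T, E) → ℝ → E := fun z t =>
    Real.exp (-(2 * L t)) • (y₀ + ∫ s in (0 : ℝ)..t, (A s (ex z s) + b s)) with hΦ₀
  have hΦc : ∀ z, ContinuousOn (Φ₀ z) (Icc 0 T) := fun z => by
    refine (Real.continuous_exp.comp_continuousOn (hLc.const_mul 2).neg).smul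
      (continuousOn_const.add ?_)
    have := intervalIntegral.continuousOn_primitive_interval' (hint z) left_mem_uIcc
    rwa [uIcc_of_le hT] at this
  set Φ : C(Icc (0 : ℝ) T, E) → C(Icc (0 : ℝ) T, E) := fun z =>
    ⟨fun t => Φ₀ z t, (hΦc z).domRestrict⟩ with hΦ
  have hcontr : ContractingWith (1 / 2) Φ := by
    refine ⟨by norm_num, LipschitzWith.of_dist_le_mul fun z z' => ?_⟩
    rw [ContinuousMap.dist_le (by positivity)]
    rintro ⟨t, ht⟩
    have hAt := fun z => ((hint z).mono_set (hsub ht))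
    have e1 : Φ z ⟨t, ht⟩ - Φ z' ⟨t, ht⟩ =
        Real.exp (-(2 * L t)) • ∫ s in (0 : ℝ)..t, A s (ex z s - ex z' s) := by
      simp only [hΦ, hΦ₀, ContinuousMap.coe_mk]
      rw [← smul_sub, add_sub_add_left_eq_sub, ← intervalIntegral.integral_sub (hAt z) (hAt z')]
      simp
    have e2 : ‖∫ s in (0 : ℝ)..t, A s (ex z s - ex z' s)‖
        ≤ ∫ s in (0 : ℝ)..t, dist z z' * (‖A s‖ * Real.exp (2 * L s)) := by
      refine intervalIntegral.norm_integral_le_of_norm_le ht.1 (Eventually.of_forall fun s _ => ?_) ?_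
      · have : ex z s - ex z' s =
            Real.exp (2 * L s) • (z (projIcc 0 T hT s) - z' (projIcc 0 T hT s)) := by
          simp only [ex, smul_sub]
        rw [this, map_smul, norm_smul, Real.norm_of_nonneg (Real.exp_nonneg _)]
        have h1 := (A s).le_opNorm (z (projIcc 0 T hT s) - z' (projIcc 0 T hT s))
        have h2 : ‖z (projIcc 0 T hT s) - z' (projIcc 0 T hT s)‖ ≤ dist z z' := by
          rw [← dist_eq_norm]; exact ContinuousMap.dist_apply_le_dist _
        calc _ ≤ Real.exp (2 * L s) * (‖A s‖ * dist z z') := by gcongr; exact h1.trans (by gcongr)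
          _ = _ := by ring
      · refine IntervalIntegrable.const_mul ?_ _
        refine ((hA.norm).mono_set (hsub ht)).mul_continuousOn ?_
        rw [uIcc_of_le ht.1]
        exact Real.continuous_exp.comp_continuousOn
          ((hLc.mono (Icc_subset_Icc_right ht.2)).const_mul 2)
    have e3 := integral_mul_exp_integral_le hA.norm (fun s => norm_nonneg _) ht
    rw [intervalIntegral.integral_const_mul] at e2
    rw [dist_eq_norm, e1, norm_smul, Real.norm_of_nonneg (Real.exp_nonneg _)]
    calc _ ≤ Real.exp (-(2 * L t)) * (dist z z' * (Real.exp (2 * L t) / 2)) := by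
          gcongr; exact e2.trans (by gcongr)
      _ = (Real.exp (-(2 * L t)) * Real.exp (2 * L t)) * (dist z z' / 2) := by ring
      _ = _ := by rw [← Real.exp_add]; simp; ring
  set z := hcontr.fixedPoint Φ
  have hz : Φ z = z := hcontr.fixedPoint_isFixedPt
  refine ⟨ex z, by simpa [uIcc_of_le hT] using hex z, fun t ht => ?_⟩
  have h1 : z ⟨t, ht⟩ = Φ₀ z t := by
    conv_lhs => rw [← hz]
    rfl
  have h2 : ex z t = Real.exp (2 * L t) • Φ₀ z t := by
    simp only [ex, projIcc_of_mem hT ht, h1]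
  rw [h2, hΦ₀]
  simp only
  rw [smul_smul, ← Real.exp_add]
  simp

end LinearODE

section AbsolutelyContinuous

theorem AbsolutelyContinuousOnInterval.of_dist_le {X Y : Type*} [PseudoMetricSpace X]
    [PseudoMetricSpace Y] {f : ℝ → X} {g : ℝ → Y} {a b : ℝ}
    (hg : AbsolutelyContinuousOnInterval g a b)
    (h : ∀ x ∈ uIcc a b, ∀ y ∈ uIcc a b, dist (f x) (f y) ≤ dist (g x) (g y)) :
    AbsolutelyContinuousOnInterval f a b := by
  rw [absolutelyContinuousOnInterval_iff] at hg ⊢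
  intro ε hε
  obtain ⟨δ, hδ, H⟩ := hg ε hε
  refine ⟨δ, hδ, fun E hE hlt => lt_of_le_of_lt (Finset.sum_le_sum fun i hi => ?_) (H E hE hlt)⟩
  exact h _ (hE.1 i hi).1 _ (hE.1 i hi).2

theorem BoundedVariationOn.of_dist_le_sub {X : Type*} [PseudoMetricSpace X] {f : ℝ → X}
    {φ : ℝ → ℝ} {a b : ℝ}
    (h : ∀ x ∈ Icc a b, ∀ y ∈ Icc a b, x ≤ y → dist (f x) (f y) ≤ φ y - φ x) :
    BoundedVariationOn f (Icc a b) := by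
  have hφ : MonotoneOn φ (Icc a b) := fun x hx y hy hxy => by
    linarith [h x hx y hy hxy, dist_nonneg (x := f x) (y := f y)]
  have hb : BoundedVariationOn φ (Icc a b) := by
    refine hφ.boundedVariationOn (C := max |φ a| |φ b|) fun x hx => ?_
    have hab := hx.1.trans hx.2
    exact abs_le_max_abs_abs (hφ ⟨le_rfl, hab⟩ hx hx.1) (hφ hx ⟨hab, le_rfl⟩ hx.2)
  refine ne_top_of_le_ne_top hb (iSup_mono fun p => Finset.sum_le_sum fun i _ => ?_)
  have h1 := p.2.2.2 i
  have h2 := p.2.2.2 (i + 1)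
  have h3 : (p.2 : ℕ → ℝ) i ≤ (p.2 : ℕ → ℝ) (i + 1) := p.2.2.1 (Nat.le_succ i)
  rw [edist_comm, edist_comm (φ _)]
  rw [edist_dist, edist_dist]
  refine ENNReal.ofReal_le_ofReal ((h _ h1 _ h2 h3).trans ?_)
  rw [dist_comm, Real.dist_eq]
  exact le_abs_self _

theorem AbsolutelyContinuousOnInterval.finset_sum {ι E : Type*} [NormedAddCommGroup E] (s : Finset ι) {f : ι → ℝ → E}
    {a b : ℝ} (hf : ∀ i ∈ s, AbsolutelyContinuousOnInterval (f i) a b) :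
    AbsolutelyContinuousOnInterval (∑ i ∈ s, f i) a b := by
  refine Finset.sum_induction f (fun g => AbsolutelyContinuousOnInterval g a b)
    (fun g g' => AbsolutelyContinuousOnInterval.add) ?_ hf
  exact AbsolutelyContinuousOnInterval.of_dist_le (g := fun x : ℝ => x)
    (LipschitzOnWith.absolutelyContinuousOnInterval (K := 1) LipschitzWith.id.lipschitzOnWith)
    (by simp)

variable {E : Type*} [NormedAddCommGroup E] [NormedSpace ℝ E]

theorem dist_le_integral_norm {F : ℝ → E} {a b : ℝ} (hF : IntervalIntegrable F volume a b)
    {h : ℝ → E} {c : E} (hh : ∀ t ∈ Icc a b, h t = c + ∫ s in a..t, F s)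
    {x y : ℝ} (hx : x ∈ Icc a b) (hy : y ∈ Icc a b) (hxy : x ≤ y) :
    dist (h x) (h y) ≤ (∫ s in a..y, ‖F s‖) - ∫ s in a..x, ‖F s‖ := by
  have hab := hx.1.trans hx.2
  have hsub : ∀ {z}, z ∈ Icc a b → uIcc a z ⊆ uIcc a b := fun {z} hz => by
    rw [uIcc_of_le hz.1, uIcc_of_le hab]; exact Icc_subset_Icc_right hz.2
  rw [dist_comm, dist_eq_norm, hh x hx, hh y hy, add_sub_add_left_eq_sub,
    intervalIntegral.integral_interval_sub_left (hF.mono_set (hsub hy)) (hF.mono_set (hsub hx)),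
    intervalIntegral.integral_interval_sub_left (hF.norm.mono_set (hsub hy))
      (hF.norm.mono_set (hsub hx))]
  exact intervalIntegral.norm_integral_le_integral_norm hxy

theorem absolutelyContinuousOnInterval_of_eq_integral {F : ℝ → E} {a b : ℝ} (hab : a ≤ b)
    (hF : IntervalIntegrable F volume a b)
    {h : ℝ → E} {c : E} (hh : ∀ t ∈ Icc a b, h t = c + ∫ s in a..t, F s) :
    AbsolutelyContinuousOnInterval h a b := by
  refine (hF.norm.absolutelyContinuousOnInterval_intervalIntegral (c := a) left_mem_uIcc).of_dist_le ?_
  rw [uIcc_of_le hab]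
  intro x hx y hy
  rcases le_total x y with hxy | hxy
  · refine (dist_le_integral_norm hF hh hx hy hxy).trans ?_
    rw [dist_comm, Real.dist_eq]; exact le_abs_self _
  · rw [dist_comm]
    refine (dist_le_integral_norm hF hh hy hx hxy).trans ?_
    rw [Real.dist_eq]; exact le_abs_self _

theorem ae_hasDerivAt_of_eq_integral [CompleteSpace E] {F : ℝ → E} {a b : ℝ} (hab : a ≤ b)
    (hF : IntervalIntegrable F volume a b)
    {h : ℝ → E} {c : E} (hh : ∀ t ∈ Icc a b, h t = c + ∫ s in a..t, F s) :
    ∀ᵐ t ∂volume.restrict (Icc a b), HasDerivAt h (F t) t := by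
  rw [← restrict_Ioo_eq_restrict_Icc, ae_restrict_iff' measurableSet_Ioo]
  filter_upwards [hF.ae_hasDerivAt_integral] with t ht hmem
  have h1 := (ht (by rw [uIcc_of_le hab]; exact Ioo_subset_Icc_self hmem) a
    left_mem_uIcc).const_add c
  refine h1.congr_of_eventuallyEq ?_
  filter_upwards [Ioo_mem_nhds hmem.1 hmem.2] with s hs
  exact hh s (Ioo_subset_Icc_self hs)

theorem AbsolutelyContinuousOnInterval.ae_differentiableAt_Icc [FiniteDimensional ℝ E]
    {f : ℝ → E} {a b : ℝ} (hab : a ≤ b) (hf : AbsolutelyContinuousOnInterval f a b) :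
    ∀ᵐ t ∂volume.restrict (Icc a b), DifferentiableAt ℝ f t := by
  rw [ae_restrict_iff' measurableSet_Icc, ← uIcc_of_le hab]
  exact hf.boundedVariationOn.ae_differentiableAt_of_mem_uIcc

/-- Integration by parts for a scalar product of absolutely continuous curves. -/
theorem integral_inner_add_inner_eq_sub {n : ℕ} {q h q' h' : ℝ → Euc n} {a b : ℝ} (hab : a ≤ b)
    (hq : AbsolutelyContinuousOnInterval q a b) (hh : AbsolutelyContinuousOnInterval h a b)
    (hq' : ∀ᵐ t ∂volume.restrict (Icc a b), HasDerivAt q (q' t) t)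
    (hh' : ∀ᵐ t ∂volume.restrict (Icc a b), HasDerivAt h (h' t) t) :
    ∫ t in Icc a b, (inner ℝ (q t) (h' t) + inner ℝ (q' t) (h t))
      = inner ℝ (q b) (h b) - inner ℝ (q a) (h a) := by
  have hcoord : ∀ {g : ℝ → Euc n}, AbsolutelyContinuousOnInterval g a b → ∀ i,
      AbsolutelyContinuousOnInterval (fun t => g t i) a b := fun hg i =>
    hg.of_dist_le fun x _ y _ => by
      rw [dist_eq_norm, dist_eq_norm, ← PiLp.sub_apply]
      exact PiLp.norm_apply_le _ i
  have hac : AbsolutelyContinuousOnInterval (fun t => inner ℝ (q t) (h t)) a b := by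
    have := AbsolutelyContinuousOnInterval.finset_sum (Finset.univ : Finset (Fin n))
      (f := fun i => (fun t => q t i) * fun t => h t i)
      (fun i _ => (hcoord hq i).mul (hcoord hh i))
    refine this.of_dist_le fun x _ y _ => le_of_eq ?_
    congr 1 <;> simp [PiLp.inner_apply, mul_comm]
  rw [← hac.integral_deriv_eq_sub, intervalIntegral.integral_of_le hab, ← integral_Icc_eq_integral_Ioc]
  refine integral_congr_ae ?_
  filter_upwards [hq', hh'] with t h1 h2
  exact (h1.inner ℝ h2).deriv.symm

end AbsolutelyContinuous

section Separation

open scoped Pointwise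

theorem Function.Embedding.sum_extend_zero {ι κ G : Type*} [Fintype ι] [Fintype κ]
    [AddCommMonoid G] (e : ι ↪ κ) (f : ι → G) :
    ∑ j, Function.extend e f 0 j = ∑ i, f i := by
  have := Finset.sum_map Finset.univ e (Function.extend e f 0)
  simp only [e.injective.extend_apply] at this
  rw [← this]
  symm
  refine Finset.sum_subset (Finset.subset_univ _) fun j _ hj => ?_
  rw [Function.extend_apply' _ _ _ (by simpa using hj)]
  rfl

/-- The convex hull of a compact set in a finite-dimensional space is compact. -/
theorem IsCompact.convexHull_finiteDimensional {E : Type*} [NormedAddCommGroup E]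
    [NormedSpace ℝ E] [FiniteDimensional ℝ E] {S : Set E} (hS : IsCompact S) :
    IsCompact (convexHull ℝ S) := by
  classical
  rcases S.eq_empty_or_nonempty with rfl | ⟨s₀, hs₀⟩
  · simp
  set d := Module.finrank ℝ E + 1
  have hK : IsCompact (stdSimplex ℝ (Fin d) ×ˢ Set.pi univ fun _ : Fin d => S) :=
    (isCompact_stdSimplex ℝ _).prod (isCompact_univ_pi fun _ => hS)
  have hf : Continuous fun wz : (Fin d → ℝ) × (Fin d → E) => ∑ i, wz.1 i • wz.2 i := by fun_prop
  convert hK.image hf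
  ext x
  constructor
  · intro hx
    obtain ⟨ι, _, z, w, hz, hai, hw, hw1, rfl⟩ := eq_pos_convex_span_of_mem_convexHull hx
    have hcard : Fintype.card ι ≤ Fintype.card (Fin d) := by
      rw [Fintype.card_fin]
      exact hai.card_le_finrank_succ.trans
        (Nat.succ_le_succ (Submodule.finrank_le _))
    obtain ⟨e⟩ := Function.Embedding.nonempty_of_card_le hcard
    refine ⟨(Function.extend e w 0, Function.extend e z fun _ => s₀), ⟨⟨fun j => ?_, ?_⟩, ?_⟩, ?_⟩
    · by_cases hj : ∃ i, e i = j
      · obtain ⟨i, rfl⟩ := hj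
        simpa only [e.injective.extend_apply] using (hw i).le
      · simp [Function.extend_apply' _ _ _ hj]
    · rw [e.sum_extend_zero, hw1]
    · intro j _
      by_cases hj : ∃ i, e i = j
      · obtain ⟨i, rfl⟩ := hj
        simp only [e.injective.extend_apply]
        exact hz ⟨i, rfl⟩
      · simp only [Function.extend_apply' _ _ _ hj]
        exact hs₀
    · simp only
      rw [← e.sum_extend_zero fun i => w i • z i]
      refine Finset.sum_congr rfl fun j _ => ?_
      by_cases hj : ∃ i, e i = j
      · obtain ⟨i, rfl⟩ := hj
        simp only [e.injective.extend_apply]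
      · simp [Function.extend_apply' _ _ _ hj]
  · rintro ⟨⟨w, z⟩, ⟨⟨hw, hw1⟩, hz⟩, rfl⟩
    exact mem_convexHull_of_exists_fintype w z hw hw1 (fun i => hz i (mem_univ i)) rfl

/-- If no vector with nonnegative coordinates in `S` makes the whole of the compact convex set `D`
negative, then `D` contains a point with nonnegative coordinates in `S` and zero ones elsewhere. -/
theorem exists_nonneg_mem_of_forall_exists_nonneg {ι : Type*} [Fintype ι] [DecidableEq ι]
    {S : Set ι} {D : Set (ι → ℝ)} (hDc : Convex ℝ D) (hDk : IsCompact D)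
    (h : ∀ v : ι → ℝ, (∀ i ∈ S, 0 ≤ v i) → ∃ d ∈ D, 0 ≤ ∑ i, d i * v i) :
    ∃ d ∈ D, (∀ i ∈ S, 0 ≤ d i) ∧ ∀ i ∉ S, d i = 0 := by
  by_contra! hcon
  set K : Set (ι → ℝ) := {y | (∀ i ∈ S, 0 ≤ y i) ∧ ∀ i ∉ S, y i = 0} with hK
  have hKc : Convex ℝ K := by
    rintro x ⟨hx, hx'⟩ y ⟨hy, hy'⟩ a b ha hb -
    refine ⟨fun i hi => ?_, fun i hi => ?_⟩
    · have := hx i hi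
      have := hy i hi
      simp only [Pi.add_apply, Pi.smul_apply, smul_eq_mul]
      positivity
    · simp [hx' i hi, hy' i hi]
  have hKcl : IsClosed K := by
    have : K = (⋂ i ∈ S, {y : ι → ℝ | 0 ≤ y i}) ∩ ⋂ i ∈ Sᶜ, {y : ι → ℝ | y i = 0} := by
      ext y; simp [hK]
    rw [this]
    refine (isClosed_biInter fun i _ => ?_).inter (isClosed_biInter fun i _ => ?_)
    · exact isClosed_le continuous_const (continuous_apply i)
    · exact isClosed_eq (continuous_apply i) continuous_const
  have hdisj : Disjoint D K := by
    rw [Set.disjoint_left]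
    rintro d hd ⟨h1, h2⟩
    obtain ⟨i, hi, hne⟩ := hcon d hd h1
    exact hne (h2 i hi)
  obtain ⟨f, u, v, hfD, huv, hfK⟩ := geometric_hahn_banach_compact_closed hDc hDk hKc hKcl hdisj
  have hv0 : v < 0 := by
    have := hfK 0 ⟨fun _ _ => le_rfl, fun _ _ => rfl⟩
    simpa using this
  have hpos : ∀ i ∈ S, 0 ≤ f (Pi.single i 1) := by
    intro i hi
    by_contra! hneg
    have hmem : (v / f (Pi.single i 1)) • (Pi.single i 1 : ι → ℝ) ∈ K := by
      refine ⟨fun j _ => ?_, fun j hj => ?_⟩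
      · have h1 : 0 ≤ v / f (Pi.single i 1) := div_nonneg_of_nonpos hv0.le hneg.le
        have h2 : 0 ≤ (Pi.single i 1 : ι → ℝ) j := by
          by_cases hij : j = i
          · subst hij; simp
          · simp [hij]
        simpa using mul_nonneg h1 h2
      · have : j ≠ i := fun e => hj (e ▸ hi)
        simp [this]
    have := hfK _ hmem
    rw [map_smul, smul_eq_mul, div_mul_cancel₀ _ hneg.ne] at this
    exact lt_irrefl _ this
  obtain ⟨d, hd, hd0⟩ := h (fun i => f (Pi.single i 1)) hpos
  have hfd : f d = ∑ i, d i * f (Pi.single i 1) := by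
    conv_lhs => rw [← Finset.univ_sum_single d]
    rw [map_sum]
    refine Finset.sum_congr rfl fun i _ => ?_
    rw [← smul_eq_mul, ← map_smul]
    congr 1
    ext j
    by_cases hij : j = i
    · subst hij; simp
    · simp [hij]
  have := hfD d hd
  linarith

/-- A minimax theorem: a sublinear function that is the maximum of a compact family of linear
functions plus a sum of absolute values, and is nonnegative on vectors with nonnegative
coordinates in `S`, admits a finite family of multipliers. -/
theorem exists_finite_multipliers {ι I J : Type*} [Fintype ι] [DecidableEq ι] [Fintype I]
    [Fintype J] {S : Set ι} {c : ℝ} (hc : 0 < c) (L : J → ι → ℝ) (G : I → ℝ → ι → ℝ)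
    {Δ : I → Set ℝ} (hΔ : ∀ i, IsCompact (Δ i)) (hG : ∀ i, ContinuousOn (G i) (Δ i))
    {J₁ : Set J} (hJ₁ : J₁.Nonempty) (J₂ : Finset J)
    (H : ∀ v : ι → ℝ, (∀ e ∈ S, 0 ≤ v e) → ∀ M : ℝ, (∀ j ∈ J₁, ∑ e, L j e * v e < M) →
      (∀ i, ∀ τ ∈ Δ i, ∑ e, G i τ e * v e < M) →
      0 ≤ c * M + ∑ j ∈ J₂, |∑ e, L j e * v e|) :
    ∃ (κ : Type) (_ : Fintype κ) (τ : κ → ℝ) (ν : κ → I → ℝ) (lam lam' : J → ℝ),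
      (∀ a i, 0 ≤ ν a i) ∧ (∀ a i, ν a i ≠ 0 → τ a ∈ Δ i) ∧ (∀ a, τ a = 0 ∨ ∃ i, τ a ∈ Δ i) ∧
      (∀ j, 0 ≤ lam j) ∧ (∀ j ∉ J₁, lam j = 0) ∧ ∑ j, lam j + ∑ a, ∑ i, ν a i = c ∧
      (∀ e ∈ S, 0 ≤ ∑ j, lam j * L j e + ∑ j ∈ J₂, lam' j * L j e
        + ∑ a, ∑ i, ν a i * G i (τ a) e) ∧
      (∀ e ∉ S, ∑ j, lam j * L j e + ∑ j ∈ J₂, lam' j * L j e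
        + ∑ a, ∑ i, ν a i * G i (τ a) e = 0) := by
  classical
  set V : Set (ι → ℝ) := (L '' J₁) ∪ ⋃ i, G i '' Δ i with hV
  have hVk : IsCompact V :=
    ((Set.toFinite J₁).image L).isCompact.union
      (isCompact_iUnion fun i => (hΔ i).image_of_continuousOn (hG i))
  have hVne : V.Nonempty := (hJ₁.image L).mono subset_union_left
  set cube : Set (J → ℝ) := Set.pi univ fun _ => Icc (-1) 1
  set Q : (J → ℝ) →ₗ[ℝ] (ι → ℝ) := ∑ j ∈ J₂, (LinearMap.proj j).smulRight (L j) with hQ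
  have hQa : ∀ lam e, Q lam e = ∑ j ∈ J₂, lam j * L j e := fun lam e => by
    simp [hQ, Finset.sum_apply]
  have hDc : Convex ℝ (c • convexHull ℝ V + Q '' cube) :=
    ((convex_convexHull ℝ V).smul c).add
      ((convex_pi fun _ _ => convex_Icc _ _).linear_image Q)
  have hDk : IsCompact (c • convexHull ℝ V + Q '' cube) :=
    (hVk.convexHull_finiteDimensional.smul c).add
      ((isCompact_univ_pi fun _ => isCompact_Icc).image Q.continuous_of_finiteDimensional)
  obtain ⟨d, hd, hdS, hdS'⟩ := exists_nonneg_mem_of_forall_exists_nonneg (S := S) hDc hDk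
    (fun v hv => by
      have hcont : Continuous fun y : ι → ℝ => ∑ e, y e * v e := by fun_prop
      obtain ⟨y, hyV, hy⟩ := hVk.exists_isMaxOn hVne hcont.continuousOn
      have hmax : 0 ≤ c * (∑ e, y e * v e) + ∑ j ∈ J₂, |∑ e, L j e * v e| := by
        refine le_of_forall_pos_le_add fun ε hε => ?_
        have hlt : ∀ z ∈ V, ∑ e, z e * v e < ∑ e, y e * v e + ε / c := fun z hz => by
          have h1 : ∑ e, z e * v e ≤ ∑ e, y e * v e := hy hz
          have h2 : 0 < ε / c := by positivity
          linarith
        have h3 := H v hv (∑ e, y e * v e + ε / c) (fun j hj => hlt _ (Or.inl ⟨j, hj, rfl⟩))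
          (fun i τ hτ => hlt _ (Or.inr (mem_iUnion.2 ⟨i, τ, hτ, rfl⟩)))
        rw [mul_add, mul_div_cancel₀ _ hc.ne'] at h3
        linarith
      refine ⟨c • y + Q fun j => SignType.sign (∑ e, L j e * v e), add_mem_add
        (smul_mem_smul_set (subset_convexHull ℝ V hyV)) ⟨_, fun j _ => ?_, rfl⟩, ?_⟩
      · rcases SignType.sign (∑ e, L j e * v e) with _ | _ | _ <;> simp
      · refine hmax.trans (le_of_eq ?_)
        simp only [Pi.add_apply, Pi.smul_apply, smul_eq_mul, hQa, add_mul, Finset.sum_add_distrib,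
          Finset.sum_mul, Finset.mul_sum, mul_assoc]
        rw [Finset.sum_comm]
        simp_rw [← Finset.mul_sum, sign_mul_self])
  obtain ⟨_, ⟨y, hy, rfl⟩, _, ⟨lam', -, rfl⟩, rfl⟩ := hd
  obtain ⟨κ, _, ω, z, hω, hω1, hz, rfl⟩ := mem_convexHull_iff_exists_fintype.1 hy
  have hθ : ∀ a, ∃ θ : J ⊕ I × ℝ, Sum.elim L (fun q => G q.1 q.2) θ = z a ∧
      Sum.elim (fun j => j ∈ J₁) (fun q => q.2 ∈ Δ q.1) θ := by
    intro a
    rcases hz a with ⟨j, hj, hja⟩ | hi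
    · exact ⟨Sum.inl j, hja, hj⟩
    · obtain ⟨i, τ, hτ, hi⟩ := mem_iUnion.1 hi
      exact ⟨Sum.inr (i, τ), hi, hτ⟩
  choose θ hθz hθ using hθ
  set τ : κ → ℝ := fun a => Sum.elim (fun _ => 0) Prod.snd (θ a) with hτ
  set ν : κ → I → ℝ := fun a i => if θ a = Sum.inr (i, τ a) then c * ω a else 0 with hν
  set la : κ → J → ℝ := fun a j => if θ a = Sum.inl j then c * ω a else 0 with hla
  have hcω : ∀ a, 0 ≤ c * ω a := fun a => mul_nonneg hc.le (hω a)
  have hsum : ∀ a, ∑ j, la a j + ∑ i, ν a i = c * ω a := by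
    intro a
    rcases h : θ a with j | ⟨i, t⟩ <;> simp [hla, hν, hτ, h]
  have hvec : ∀ a e, ∑ j, la a j * L j e + ∑ i, ν a i * G i (τ a) e = c * ω a * z a e := by
    intro a e
    rw [← hθz a]
    rcases h : θ a with j | ⟨i, t⟩ <;> simp [hla, hν, hτ, h]
  have hd : ∀ e, (c • ∑ a, ω a • z a + Q lam') e = ∑ j, (∑ a, la a j) * L j e
      + ∑ j ∈ J₂, lam' j * L j e + ∑ a, ∑ i, ν a i * G i (τ a) e := by
    intro e
    have h1 : ∑ j, (∑ a, la a j) * L j e + ∑ a, ∑ i, ν a i * G i (τ a) e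
        = ∑ a, c * ω a * z a e := by
      simp_rw [Finset.sum_mul]
      rw [Finset.sum_comm, ← Finset.sum_add_distrib]
      exact Finset.sum_congr rfl fun a _ => hvec a e
    have h2 : (c • ∑ a, ω a • z a) e = ∑ a, c * ω a * z a e := by
      simp [Finset.sum_apply, Finset.mul_sum, mul_assoc]
    rw [Pi.add_apply, h2, hQa, ← h1]
    ring
  refine ⟨κ, inferInstance, τ, ν, fun j => ∑ a, la a j, lam', fun a i => ?_, fun a i h => ?_,
    fun a => ?_, fun j => Finset.sum_nonneg fun a _ => ?_, fun j hj => ?_, ?_, fun e he => ?_,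
    fun e he => ?_⟩
  · simp only [hν]; split_ifs; exacts [hcω a, le_rfl]
  · have h1 : θ a = Sum.inr (i, τ a) := by
      by_contra hne
      exact h (by simp [hν, hne])
    have := hθ a
    rw [h1] at this
    exact this
  · rcases h : θ a with j | ⟨i, t⟩
    · left; simp [hτ, h]
    · right
      refine ⟨i, ?_⟩
      have := hθ a
      rw [h] at this
      simpa [hτ, h] using this
  · simp only [hla]; split_ifs; exacts [hcω a, le_rfl]
  · refine Finset.sum_eq_zero fun a _ => ?_
    simp only [hla]
    rw [if_neg]
    intro h
    have := hθ a
    rw [h] at this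
    exact hj this
  · rw [Finset.sum_comm, ← Finset.sum_add_distrib, Finset.sum_congr rfl fun a _ => hsum a,
      ← Finset.mul_sum, hω1, mul_one]
  · rw [← hd]; exact hdS e he
  · rw [← hd]; exact hdS' e he

end Separation

section Adjoint

theorem MeasureTheory.Integrable.clm_apply_of_bounded {α E F : Type*} [MeasurableSpace α]
    [NormedAddCommGroup E] [NormedSpace ℝ E] [NormedAddCommGroup F] [NormedSpace ℝ F]
    {μ : Measure α} {A : α → E →L[ℝ] F} (hA : Integrable A μ) {p : α → E}
    (hp : AEStronglyMeasurable p μ) {C : ℝ} (hC : ∀ᵐ t ∂μ, ‖p t‖ ≤ C) :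
    Integrable (fun t => A t (p t)) μ := by
  refine Integrable.mono' (hA.norm.mul_const C)
    (isBoundedBilinearMap_apply.continuous.comp_aestronglyMeasurable
      (hA.aestronglyMeasurable.prodMk hp)) ?_
  filter_upwards [hC] with t ht
  exact (A t).le_opNorm_of_le ht

theorem MeasureTheory.Integrable.inner_of_bounded {α E : Type*} [MeasurableSpace α]
    [NormedAddCommGroup E] [InnerProductSpace ℝ E]
    {μ : Measure α} {b : α → E} (hb : Integrable b μ) {p : α → E}
    (hp : AEStronglyMeasurable p μ) {C : ℝ} (hC : ∀ᵐ t ∂μ, ‖p t‖ ≤ C) :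
    Integrable (fun t => inner ℝ (p t) (b t)) μ := by
  refine Integrable.mono' (hb.norm.const_mul C) (hp.inner hb.aestronglyMeasurable) ?_
  filter_upwards [hC] with t ht
  exact (norm_inner_le_norm _ _).trans (by gcongr)

/-- The adjoint equation with finitely many jumps `G a` at the points `τ a` is solvable, and its
solution is in duality with the solutions of the linear equation `h' = A h + b`. -/
theorem exists_adjoint_arc {n : ℕ} {T : ℝ} (hT : 0 < T) {A : ℝ → Euc n →L[ℝ] Euc n}
    (hA : Integrable A (volume.restrict (Icc 0 T))) {κ : Type*} [Fintype κ] (τ : κ → ℝ)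
    (hτ : ∀ a, τ a ∈ Icc 0 T) (G : κ → Euc n) (qT : Euc n) :
    ∃ p : ℝ → Euc n, BoundedVariationOn p (Icc 0 T) ∧ Tendsto p (𝓝[<] T) (𝓝 (p T)) ∧
      (∀ t ∈ Icc 0 T, p t + ∑ a, (if t ≤ τ a then G a else 0)
        - ∫ s in Icc t T, ContinuousLinearMap.adjoint (A s) (p s) = qT) ∧
      ∀ h b : ℝ → Euc n, Integrable b (volume.restrict (Icc 0 T)) → ContinuousOn h (Icc 0 T) →
        (∀ t ∈ Icc 0 T, h t = h 0 + ∫ s in (0 : ℝ)..t, (A s (h s) + b s)) →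
        inner ℝ qT (h T) - inner ℝ (p 0) (h 0)
          = (∫ t in Icc 0 T, inner ℝ (p t) (b t)) + ∑ a, inner ℝ (G a) (h (τ a)) := by
  classical
  have hii : ∀ {E : Type} [NormedAddCommGroup E] {F : ℝ → E},
      Integrable F (volume.restrict (Icc 0 T)) ↔ IntervalIntegrable F volume 0 T := fun {E} _ {F} =>
    (intervalIntegrable_iff_integrableOn_Icc_of_le hT.le).symm
  set B : ℝ → Euc n →L[ℝ] Euc n := fun s => ContinuousLinearMap.adjoint (A s) with hB
  have hBi : Integrable B (volume.restrict (Icc 0 T)) :=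
    hA.mono (ContinuousLinearMap.adjoint.continuous.comp_aestronglyMeasurable
      hA.aestronglyMeasurable) (Eventually.of_forall fun s => by simp [hB])
  set m : ℝ → Euc n := fun t => ∑ a, (if t ≤ τ a then G a else 0) with hm
  have hmm : Measurable m := Finset.measurable_sum _ fun a _ =>
    Measurable.ite measurableSet_Iic measurable_const measurable_const
  have hmb : ∀ t, ‖m t‖ ≤ ∑ a, ‖G a‖ := fun t => by
    refine (norm_sum_le _ _).trans (Finset.sum_le_sum fun a _ => ?_)
    split_ifs <;> simp
  have hBm : Integrable (fun t => B t (m t)) (volume.restrict (Icc 0 T)) :=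
    hBi.clm_apply_of_bounded hmm.aestronglyMeasurable (Eventually.of_forall hmb)
  have hBr : IntervalIntegrable (fun σ => B (T - σ)) volume 0 T := by
    simpa using ((hii.1 hBi).comp_sub_left T).symm
  have hBmr : IntervalIntegrable (fun σ => - B (T - σ) (m (T - σ))) volume 0 T := by
    have : IntervalIntegrable (fun σ => B (T - σ) (m (T - σ))) volume 0 T := by
      simpa using ((hii.1 hBm).comp_sub_left T).symm
    exact this.neg
  obtain ⟨y, hyc, hy⟩ := exists_linear_ode hT.le hBr hBmr qT
  set q : ℝ → Euc n := fun t => y (T - t) with hq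
  have hqc : ContinuousOn q (Icc 0 T) := hyc.comp (by fun_prop) fun t ht =>
    ⟨by linarith [ht.2], by linarith [ht.1]⟩
  set p : ℝ → Euc n := fun t => q t - m t with hp
  have hpm : AEStronglyMeasurable p (volume.restrict (Icc 0 T)) :=
    (hqc.aestronglyMeasurable measurableSet_Icc).sub hmm.aestronglyMeasurable
  obtain ⟨C, hC⟩ := isCompact_Icc.exists_bound_of_continuousOn hqc
  have hpb : ∀ᵐ t ∂volume.restrict (Icc 0 T), ‖p t‖ ≤ C + ∑ a, ‖G a‖ := by
    filter_upwards [ae_restrict_mem measurableSet_Icc] with t ht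
    exact (norm_sub_le _ _).trans (add_le_add (hC t ht) (hmb t))
  have hBp : Integrable (fun t => B t (p t)) (volume.restrict (Icc 0 T)) :=
    hBi.clm_apply_of_bounded hpm hpb
  have hsub : ∀ {x z}, x ∈ Icc 0 T → z ∈ Icc 0 T → uIcc x z ⊆ uIcc 0 T := fun {x z} hx hz => by
    rw [uIcc_of_le hT.le]; exact uIcc_subset_Icc hx hz
  have hqT : ∀ t ∈ Icc 0 T, q t = qT + ∫ s in t..T, B s (p s) := by
    intro t ht
    have h1 := hy (T - t) ⟨by linarith [ht.2], by linarith [ht.1]⟩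
    have h2 := intervalIntegral.integral_comp_sub_left (a := 0) (b := T - t)
      (fun s => B s (p s)) T
    rw [sub_sub_cancel, sub_zero] at h2
    rw [hq]
    simp only
    rw [h1, ← h2]
    congr 1
    refine intervalIntegral.integral_congr fun σ _ => ?_
    simp [hp, hq, sub_eq_add_neg]
  have h0m : (0 : ℝ) ∈ Icc 0 T := ⟨le_rfl, hT.le⟩
  have hTm : T ∈ Icc 0 T := ⟨hT.le, le_rfl⟩
  have hq0 : ∀ t ∈ Icc 0 T, q t = q 0 + ∫ s in (0 : ℝ)..t, -(B s (p s)) := by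
    intro t ht
    rw [hqT t ht, hqT 0 h0m, intervalIntegral.integral_neg,
      ← intervalIntegral.integral_add_adjacent_intervals
        ((hii.1 hBp).mono_set (hsub h0m ht)) ((hii.1 hBp).mono_set (hsub ht hTm))]
    abel
  have hnBp : IntervalIntegrable (fun t => -(B t (p t))) volume 0 T := (hii.1 hBp).neg
  refine ⟨p, ?_, ?_, fun t ht => ?_, ?_⟩
  · refine BoundedVariationOn.of_dist_le_sub (φ := fun t => (∫ s in (0 : ℝ)..t, ‖-(B s (p s))‖)
      - ∑ a, if t ≤ τ a then ‖G a‖ else 0) fun x hx z hz hxz => ?_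
    have h1 := dist_le_integral_norm hnBp hq0 hx hz hxz
    have h2 : dist (m x) (m z) ≤ (∑ a, if x ≤ τ a then ‖G a‖ else 0)
        - ∑ a, if z ≤ τ a then ‖G a‖ else 0 := by
      rw [dist_eq_norm, hm]
      simp only
      rw [← Finset.sum_sub_distrib, ← Finset.sum_sub_distrib]
      refine (norm_sum_le _ _).trans (Finset.sum_le_sum fun a _ => ?_)
      by_cases hz' : z ≤ τ a
      · simp [hz', hxz.trans hz']
      · by_cases hx' : x ≤ τ a <;> simp [hz', hx']
    have h3 : dist (p x) (p z) ≤ dist (q x) (q z) + dist (m x) (m z) := dist_sub_sub_le _ _ _ _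
    linarith
  · have h1 : Tendsto q (𝓝[<] T) (𝓝 (q T)) :=
      (hqc T hTm).mono_left (nhdsWithin_le_of_mem
        (mem_of_superset (Ico_mem_nhdsLT hT) Ico_subset_Icc_self))
    refine h1.sub (tendsto_finsetSum _ fun a _ => ?_)
    rcases (hτ a).2.lt_or_eq with h | h
    · refine tendsto_const_nhds.congr' ?_
      filter_upwards [Ioo_mem_nhdsLT h] with t ht
      rw [if_neg (not_le.2 h), if_neg (not_le.2 ht.1)]
    · refine tendsto_const_nhds.congr' ?_
      filter_upwards [self_mem_nhdsWithin] with t ht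
      rw [if_pos h.ge, if_pos (h ▸ (mem_Iio.1 ht).le)]
  · have h1 := hqT t ht
    rw [integral_Icc_eq_integral_Ioc, ← intervalIntegral.integral_of_le ht.2]
    change q t - m t + m t - _ = qT
    rw [sub_add_cancel, h1, add_sub_cancel_right]
  · intro h b hb hhc hh
    have hAh : Integrable (fun s => A s (h s) + b s) (volume.restrict (Icc 0 T)) := by
      refine Integrable.add ?_ hb
      rw [hii]
      exact (hii.1 hA).clm_apply_continuousOn (by rwa [uIcc_of_le hT.le])
    have e1 := integral_inner_add_inner_eq_sub hT.le
      (absolutelyContinuousOnInterval_of_eq_integral hT.le hnBp hq0)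
      (absolutelyContinuousOnInterval_of_eq_integral hT.le (hii.1 hAh) hh)
      (ae_hasDerivAt_of_eq_integral hT.le hnBp hq0)
      (ae_hasDerivAt_of_eq_integral hT.le (hii.1 hAh) hh)
    have e2 : ∀ t, inner ℝ (q t) (A t (h t) + b t) + inner ℝ (-(B t (p t))) (h t)
        = inner ℝ (p t) (b t) + inner ℝ (m t) (A t (h t) + b t) := by
      intro t
      have : q t = p t + m t := by simp [hp]
      rw [this, inner_neg_left, hB]
      simp only
      rw [ContinuousLinearMap.adjoint_inner_left, inner_add_left, inner_add_right (p t)]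
      ring
    have e3 : ∫ t in Icc 0 T, inner ℝ (m t) (A t (h t) + b t)
        = ∑ a, (inner ℝ (G a) (h (τ a)) - inner ℝ (G a) (h 0)) := by
      have : ∀ t, inner ℝ (m t) (A t (h t) + b t)
          = ∑ a, (Iic (τ a)).indicator (fun t => inner ℝ (G a) (A t (h t) + b t)) t := by
        intro t
        rw [hm]
        simp only
        rw [sum_inner]
        refine Finset.sum_congr rfl fun a _ => ?_
        by_cases hta : t ≤ τ a <;> simp [hta, indicator]
      simp_rw [this]
      rw [integral_finsetSum]
      · refine Finset.sum_congr rfl fun a _ => ?_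
        rw [integral_indicator measurableSet_Iic, Measure.restrict_restrict measurableSet_Iic]
        have hset : Iic (τ a) ∩ Icc 0 T = Icc 0 (τ a) := by
          ext t
          simp only [mem_inter_iff, mem_Iic, mem_Icc]
          exact ⟨fun ht => ⟨ht.2.1, ht.1⟩, fun ht => ⟨ht.2, ht.1, ht.2.trans (hτ a).2⟩⟩
        rw [hset, integral_inner (hAh.mono_measure
            (Measure.restrict_mono (Icc_subset_Icc_right (hτ a).2) le_rfl)),
          integral_Icc_eq_integral_Ioc, ← intervalIntegral.integral_of_le (hτ a).1, ← inner_sub_right]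
        rw [hh (τ a) (hτ a)]
        simp
      · intro a _
        exact ((hAh.const_inner (G a))).indicator measurableSet_Iic
    have e4 : Integrable (fun t => inner ℝ (m t) (A t (h t) + b t)) (volume.restrict (Icc 0 T)) :=
      hAh.inner_of_bounded hmm.aestronglyMeasurable (Eventually.of_forall hmb)
    rw [integral_congr_ae (Eventually.of_forall e2),
      integral_add (hb.inner_of_bounded hpm hpb) e4, e3, Finset.sum_sub_distrib] at e1
    have e5 : ∑ a, inner ℝ (G a) (h 0) = inner ℝ (m 0) (h 0) := by
      rw [hm]
      simp only
      rw [sum_inner]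
      refine Finset.sum_congr rfl fun a _ => ?_
      rw [if_pos (hτ a).1]
    have e6 : q T = qT := by rw [hqT T hTm]; simp
    have e7 : inner ℝ (q 0) (h 0) = inner ℝ (p 0) (h 0) + inner ℝ (m 0) (h 0) := by
      rw [← inner_add_left]; simp [hp]
    rw [e5, e6, e7] at e1
    linarith

end Adjoint

theorem HasDerivAt.eventually_le_add_mul {φ : ℝ → ℝ} {φ' M : ℝ} (hφ : HasDerivAt φ φ' 0)
    (hM : φ' < M) : ∀ᶠ a in 𝓝[>] (0 : ℝ), φ a ≤ φ 0 + a * M := by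
  have h1 := (hasDerivAt_iff_isLittleO_nhds_zero.1 hφ).bound (sub_pos.2 hM)
  filter_upwards [nhdsWithin_le_nhds h1, self_mem_nhdsWithin] with a ha ha0
  have ha0' : 0 < a := ha0
  rw [zero_add, Real.norm_eq_abs, Real.norm_of_nonneg ha0'.le, smul_eq_mul] at ha
  linarith [(abs_le.1 ha).2]

theorem HasDerivAt.eventually_abs_le_mul {φ : ℝ → ℝ} {φ' ε : ℝ} (hφ : HasDerivAt φ φ' 0)
    (h0 : φ 0 = 0) (hε : 0 < ε) : ∀ᶠ a in 𝓝[>] (0 : ℝ), |φ a| ≤ a * (|φ'| + ε) := by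
  filter_upwards [hφ.eventually_le_add_mul (M := |φ'| + ε) (by linarith [le_abs_self φ']),
    hφ.neg.eventually_le_add_mul (M := |φ'| + ε) (by linarith [neg_le_abs φ'])] with a h1 h2
  simp only [Pi.neg_apply, h0, neg_zero, zero_add] at h1 h2
  exact abs_le.2 ⟨by linarith, h1⟩

namespace ControlProblem

variable {n m l r s : ℕ} (P : ControlProblem n m l r s)

/-- The derivative `f'_x` along the process `(xb,ub)`, as part of the derivative in `(x,u)`. -/
def linDyn (xb : ℝ → Euc n) (ub : ℝ → Euc m) (t : ℝ) : Euc n →L[ℝ] Euc n :=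
  (fderiv ℝ (P.fpair t) (xb t, ub t)).comp (ContinuousLinearMap.inl ℝ (Euc n) (Euc m))

theorem integrable_linDyn {xb : ℝ → Euc n} {ub : ℝ → Euc m} (hdyn : P.DynamicsRegular xb ub) :
    Integrable (P.linDyn xb ub) P.leb :=
  (((ContinuousLinearMap.compL ℝ (Euc n) (Euc n × Euc m) (Euc n)).flip
    (ContinuousLinearMap.inl ℝ (Euc n) (Euc m))).integrable_comp hdyn.summable_deriv)

theorem hasDerivAt_ell {xb : ℝ → Euc n} (hend : P.EndpointRegular xb) (h : ℝ → Euc n)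
    (j : Fin (r + 1)) :
    HasDerivAt (fun a : ℝ => P.ell j (P.ends fun t => xb t + a • h t))
      (fderiv ℝ (P.ell j) (P.ends xb) (P.ends h)) 0 := by
  have h1 : HasDerivAt (fun a : ℝ => P.ends xb + a • P.ends h) (P.ends h) 0 := by
    simpa using ((hasDerivAt_id (0 : ℝ)).smul_const (P.ends h)).const_add (P.ends xb)
  have h2 : HasFDerivAt (P.ell j) (fderiv ℝ (P.ell j) (P.ends xb))
      (P.ends xb + (0 : ℝ) • P.ends h) := by
    rw [zero_smul, add_zero]
    exact ((hend j).1.differentiableAt one_ne_zero).hasFDerivAt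
  exact h2.comp_hasDerivAt 0 h1

theorem eventually_state_le {xb h : ℝ → Euc n} (hstate : P.StateRegular xb)
    (hxb : ContinuousOn xb (Icc 0 P.T)) (hh : ContinuousOn h (Icc 0 P.T)) (i : Fin s)
    (hle : ∀ t ∈ Icc 0 P.T, P.g i t (xb t) ≤ 0) {M : ℝ}
    (hM : ∀ t ∈ P.active xb i, fderiv ℝ (P.g i t) (xb t) (h t) < M) :
    ∀ᶠ a in 𝓝[>] (0 : ℝ), ∀ t ∈ Icc 0 P.T, P.g i t (xb t + a • h t) ≤ a * M := by
  have hxc := hxb.domRestrict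
  have hhc := hh.domRestrict
  have hpath : Continuous fun z : ℝ × Icc 0 P.T =>
      ((z.2 : ℝ), xb z.2 + z.1 • h z.2) := by
    refine (continuous_subtype_val.comp continuous_snd).prodMk ?_
    exact (hxc.comp continuous_snd).add (continuous_fst.smul (hhc.comp continuous_snd))
  have hmem : ∀ z : ℝ × Icc 0 P.T, ((z.2 : ℝ), xb z.2 + z.1 • h z.2)
      ∈ Icc 0 P.T ×ˢ (univ : Set (Euc n)) := fun z => ⟨z.2.2, mem_univ _⟩
  have hG : Continuous fun z : ℝ × Icc 0 P.T => P.g i z.2 (xb z.2 + z.1 • h z.2) :=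
    (hstate.cont i).comp_continuous hpath hmem
  have hD : Continuous fun z : ℝ × Icc 0 P.T =>
      fderiv ℝ (P.g i z.2) (xb z.2 + z.1 • h z.2) (h z.2) :=
    ((hstate.cont_deriv i).comp_continuous hpath hmem).clm_apply (hhc.comp continuous_snd)
  have key : ∀ᶠ a in 𝓝 (0 : ℝ), ∀ t ∈ (univ : Set (Icc 0 P.T)),
      0 < a → P.g i t (xb t + a • h t) ≤ a * M := by
    refine isCompact_univ.eventually_forall_of_forall_eventually fun t₀ _ => ?_
    rcases (hle t₀ t₀.2).lt_or_eq with hlt | heq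
    · have hc : Continuous fun z : ℝ × Icc 0 P.T =>
          P.g i z.2 (xb z.2 + z.1 • h z.2) - z.1 * M := hG.sub (continuous_fst.mul_const M)
      have := hc.continuousAt (x := ((0 : ℝ), t₀)) |>.eventually_lt (g := fun _ => (0 : ℝ))
        continuousAt_const (by simpa using hlt)
      filter_upwards [this] with z hz _
      linarith
    · have hlt := hM t₀ ⟨t₀.2, heq⟩
      have := hD.continuousAt (x := ((0 : ℝ), t₀)) |>.eventually_lt (g := fun _ => M)
        continuousAt_const (by simpa using hlt)
      rw [nhds_prod_eq, eventually_prod_iff] at this ⊢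
      obtain ⟨pa, hpa, pb, hpb, H⟩ := this
      obtain ⟨ε, hε, hball⟩ := Metric.eventually_nhds_iff.1 hpa
      refine ⟨fun a => |a| < ε, Metric.eventually_nhds_iff.2 ⟨ε, hε, fun a ha => by
        simpa using ha⟩, pb, hpb, fun {a} ha {t} ht ha0 => ?_⟩
      have hder : ∀ σ : ℝ, HasDerivAt (fun σ : ℝ => P.g i t (xb t + σ • h t))
          (fderiv ℝ (P.g i t) (xb t + σ • h t) (h t)) σ := by
        intro σ
        have h1 : HasDerivAt (fun σ : ℝ => xb t + σ • h t) (h t) σ := by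
          simpa using ((hasDerivAt_id σ).smul_const (h t)).const_add (xb t)
        exact (hstate.diff i t t.2 _).hasFDerivAt.comp_hasDerivAt σ h1
      have h2 := (convex_Icc (0 : ℝ) a).image_sub_le_mul_sub_of_deriv_le
        (f := fun σ : ℝ => P.g i t (xb t + σ • h t)) (C := M)
        (fun σ _ => (hder σ).continuousAt.continuousWithinAt)
        (fun σ _ => (hder σ).differentiableAt.differentiableWithinAt)
        (fun σ hσ => by
          rw [interior_Icc] at hσ
          rw [(hder σ).deriv]
          refine (H (hball ?_) ht).le
          rw [Real.dist_eq, sub_zero, abs_of_pos hσ.1]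
          exact hσ.2.trans (lt_of_abs_lt ha))
        0 ⟨le_rfl, ha0.le⟩ a ⟨ha0.le, le_rfl⟩ ha0.le
      have h3 := hle t t.2
      simp only [zero_smul, add_zero, sub_zero] at h2
      linarith
  filter_upwards [nhdsWithin_le_nhds key, self_mem_nhdsWithin] with a ha ha0 t ht
  exact ha ⟨t, ht⟩ (mem_univ _) ha0

theorem eventually_psi_le {xb h : ℝ → Euc n} {ub : ℝ → Euc m} (hfeas : P.IsFeasible xb ub)
    (hend : P.EndpointRegular xb) (hstate : P.StateRegular xb)
    (hh : ContinuousOn h (Icc 0 P.T)) {M : ℝ}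
    (hM0 : fderiv ℝ (P.ell 0) (P.ends xb) (P.ends h) < M)
    (hMj : ∀ j : Fin (r + 1), 1 ≤ j.val → j.val ≤ l → P.ell j (P.ends xb) = 0 →
      fderiv ℝ (P.ell j) (P.ends xb) (P.ends h) < M)
    (hMi : ∀ i, ∀ t ∈ P.active xb i, fderiv ℝ (P.g i t) (xb t) (h t) < M) :
    ∀ᶠ a in 𝓝[>] (0 : ℝ), P.psi xb (fun t => xb t + a • h t) ≤ a * M := by
  have hxb : ContinuousOn xb (Icc 0 P.T) := by
    simpa [uIcc_of_le P.T_pos.le] using hfeas.arc.continuousOn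
  have h0 := (P.hasDerivAt_ell hend h 0).eventually_le_add_mul hM0
  have hj : ∀ᶠ a in 𝓝[>] (0 : ℝ), ∀ j : Fin (r + 1), 1 ≤ j.val → j.val ≤ l →
      P.ell j (P.ends fun t => xb t + a • h t) ≤ a * M := by
    refine eventually_all.2 fun j => ?_
    by_cases hj : 1 ≤ j.val ∧ j.val ≤ l
    · rcases (hfeas.endpoint_le j hj.1 hj.2).lt_or_eq with hlt | heq
      · have hc := (P.hasDerivAt_ell hend h j).continuousAt.sub
          (continuousAt_id.mul_const M)
        have := hc.eventually_lt (g := fun _ => (0 : ℝ)) continuousAt_const (by simpa using hlt)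
        filter_upwards [nhdsWithin_le_nhds this] with a ha _ _
        simp only [Pi.sub_apply, id] at ha
        linarith
      · filter_upwards [(P.hasDerivAt_ell hend h j).eventually_le_add_mul
          (hMj j hj.1 hj.2 heq)] with a ha _ _
        simpa [heq] using ha
    · exact Eventually.of_forall fun a h1 h2 => absurd ⟨h1, h2⟩ hj
  have hi : ∀ᶠ a in 𝓝[>] (0 : ℝ), ∀ i, ∀ t ∈ Icc 0 P.T,
      P.g i t (xb t + a • h t) ≤ a * M :=
    eventually_all.2 fun i => P.eventually_state_le hstate hxb hh i (hfeas.state i) (hMi i)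
  filter_upwards [h0, hj, hi] with a h0 hj hi
  refine csSup_le ⟨_, Or.inl (Or.inl rfl)⟩ ?_
  rintro y ((rfl | ⟨j, h1, h2, rfl⟩) | ⟨i, t, ht, rfl⟩)
  · simp only [zero_smul, add_zero] at h0
    linarith
  · exact hj j h1 h2
  · exact hi i t ht

theorem psi_self_nonneg {xb : ℝ → Euc n} {ub : ℝ → Euc m} (hfeas : P.IsFeasible xb ub) :
    0 ≤ P.psi xb xb := by
  refine le_csSup ⟨0, ?_⟩ (Or.inl (Or.inl (by simp)))
  rintro y ((rfl | ⟨j, h1, h2, rfl⟩) | ⟨i, t, ht, rfl⟩)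
  · simp
  · exact hfeas.endpoint_le j h1 h2
  · exact hfeas.state i t ht

theorem norm_defect_le {E : Type*} [NormedAddCommGroup E] [NormedSpace ℝ E] {k : ℕ}
    {F₀ F₁ a₁ D R : E} {W₀ W₁ : Fin k → E} {β κ : Fin k → ℝ} {a C α δ : ℝ} (ha : 0 < a)
    (ha1 : a ≤ 1) (hR : F₁ - F₀ - a • a₁ - (a ^ 2 / 2) • D = R)
    (hW : ∀ i, ‖W₁ i - W₀ i‖ ≤ a * (C * κ i)) (ha₁ : ‖a₁‖ ≤ α) (hD : ‖D‖ ≤ δ) :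
    ‖F₀ + a • (a₁ + ∑ i, β i • (W₀ i - F₀)) - F₁ - ∑ i, (a * β i) • (W₁ i - F₁)‖
      ≤ (1 + ∑ i, |β i|) * ‖R‖
        + a ^ 2 * ((1 + ∑ i, |β i|) * δ + (∑ i, |β i|) * α + C * ∑ i, |β i| * κ i) := by
  have e : F₀ + a • (a₁ + ∑ i, β i • (W₀ i - F₀)) - F₁ - ∑ i, (a * β i) • (W₁ i - F₁)
      = -(R + (a ^ 2 / 2) • D)
        + ∑ i, (a * β i) • ((R + a • a₁ + (a ^ 2 / 2) • D) - (W₁ i - W₀ i)) := by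
    have hF : F₁ = F₀ + (R + a • a₁ + (a ^ 2 / 2) • D) := by rw [← hR]; abel
    rw [smul_add, Finset.smul_sum]
    have : ∀ i, (a * β i) • ((R + a • a₁ + (a ^ 2 / 2) • D) - (W₁ i - W₀ i))
        = a • β i • (W₀ i - F₀) - (a * β i) • (W₁ i - F₁) := fun i => by
      rw [smul_smul, ← smul_sub]
      congr 1
      rw [hF]; abel
    simp_rw [this]
    rw [Finset.sum_sub_distrib, hF]
    abel
  have hα : 0 ≤ α := (norm_nonneg _).trans ha₁
  have hδ : 0 ≤ δ := (norm_nonneg _).trans hD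
  have h1 : ‖(a ^ 2 / 2) • D‖ ≤ a ^ 2 * δ := by
    rw [norm_smul, Real.norm_of_nonneg (by positivity)]
    exact mul_le_mul (by nlinarith) hD (norm_nonneg _) (by positivity)
  have h2 : ‖a • a₁‖ ≤ a * α := by
    rw [norm_smul, Real.norm_of_nonneg ha.le]; gcongr
  have h3 : ∀ i, ‖(a * β i) • ((R + a • a₁ + (a ^ 2 / 2) • D) - (W₁ i - W₀ i))‖
      ≤ |β i| * ‖R‖ + a ^ 2 * (|β i| * δ + |β i| * α + C * (|β i| * κ i)) := fun i => by
    have h4 : ‖(R + a • a₁ + (a ^ 2 / 2) • D) - (W₁ i - W₀ i)‖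
        ≤ ‖R‖ + a * α + a ^ 2 * δ + a * (C * κ i) :=
      (norm_sub_le _ _).trans (add_le_add ((norm_add_le _ _).trans
        (add_le_add ((norm_add_le _ _).trans (add_le_add le_rfl h2)) h1)) (hW i))
    rw [norm_smul, norm_mul, Real.norm_of_nonneg ha.le, Real.norm_eq_abs]
    have h5 : a * ‖R‖ ≤ ‖R‖ := mul_le_of_le_one_left (norm_nonneg _) ha1
    have h6 : a * (a ^ 2 * δ) ≤ a ^ 2 * δ := mul_le_of_le_one_left (by positivity) ha1
    calc a * |β i| * _ ≤ a * |β i| * (‖R‖ + a * α + a ^ 2 * δ + a * (C * κ i)) := by gcongr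
      _ = |β i| * (a * ‖R‖ + a * (a ^ 2 * δ) + a ^ 2 * (α + C * κ i)) := by ring
      _ ≤ |β i| * (‖R‖ + a ^ 2 * δ + a ^ 2 * (α + C * κ i)) := by gcongr
      _ = _ := by ring
  rw [e]
  have h7 := norm_add_le (-(R + (a ^ 2 / 2) • D))
    (∑ i, (a * β i) • ((R + a • a₁ + (a ^ 2 / 2) • D) - (W₁ i - W₀ i)))
  have h8 : ‖-(R + (a ^ 2 / 2) • D)‖ ≤ ‖R‖ + a ^ 2 * δ := by
    rw [norm_neg]; exact (norm_add_le _ _).trans (add_le_add le_rfl h1)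
  have h9 := (norm_sum_le Finset.univ
    fun i => (a * β i) • ((R + a • a₁ + (a ^ 2 / 2) • D) - (W₁ i - W₀ i))).trans
    (Finset.sum_le_sum fun i _ => h3 i)
  rw [Finset.sum_add_distrib, ← Finset.mul_sum, Finset.sum_add_distrib, Finset.sum_add_distrib,
    ← Finset.sum_mul, ← Finset.sum_mul, ← Finset.sum_mul, ← Finset.mul_sum] at h9
  linarith

/-- Along a solution of the linearized equation the defect of the control system is of second
order. -/
theorem eventually_lintegral_defect_le {k : ℕ} {xb h : ℝ → Euc n} {ub : ℝ → Euc m}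
    {w : Fin k → ℝ → Euc m} {β : Fin k → ℝ} (hfeas : P.IsFeasible xb ub)
    (hdyn : P.DynamicsRegular xb ub) (hw : ∀ i, P.GoodControl xb (w i)) (hh : P.IsArc h)
    (hode : ∀ᵐ t ∂P.leb, HasDerivAt h (P.linDyn xb ub t (h t)
      + ∑ i, β i • (P.f t (xb t) (w i t) - P.f t (xb t) (ub t))) t) :
    ∃ K : ℝ, ∀ᶠ a in 𝓝[>] (0 : ℝ),
      ∫⁻ t, ‖deriv (fun t => xb t + a • h t) t - P.f t (xb t + a • h t) (ub t)
        - ∑ i, (a * β i) • (P.f t (xb t + a • h t) (w i t)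
          - P.f t (xb t + a • h t) (ub t))‖ₑ ∂P.leb ≤ ENNReal.ofReal (K * a ^ 2) := by
  obtain ⟨D, hD, hrem⟩ := hdyn.second_order
  obtain ⟨a₀, ha₀, hrem⟩ := hrem h hh (fun _ => 0) MemLp.zero 1 one_pos
  choose hsel γ hγ κ hκ hlip using hw
  obtain ⟨C, hC⟩ := hh.exists_bound
  rw [uIcc_of_le P.T_pos.le] at hC
  have hC0 : 0 ≤ C := (norm_nonneg _).trans (hC 0 ⟨le_rfl, P.T_pos.le⟩)
  set B := ∑ i, |β i|
  have hB : 0 ≤ B := Finset.sum_nonneg fun i _ => abs_nonneg _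
  set N : ℝ → ℝ := fun t => (1 + B) * (‖D t‖ * C ^ 2) + B * (‖P.linDyn xb ub t‖ * C)
    + C * ∑ i, |β i| * |κ i t| with hN
  have hNi : Integrable N P.leb := by
    refine (((hD.norm.mul_const _).const_mul _).add
      (((P.integrable_linDyn hdyn).norm.mul_const _).const_mul _)).add (Integrable.const_mul ?_ C)
    exact integrable_finsetSum _ fun i _ => (hκ i).abs.const_mul _
  have hN0 : ∀ t, 0 ≤ N t := fun t => by
    have : 0 ≤ ∑ i, |β i| * |κ i t| := Finset.sum_nonneg fun i _ => by positivity
    simp only [hN]; positivity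
  refine ⟨(1 + B) + ∫ t, N t ∂P.leb, ?_⟩
  have hsmall : ∀ᶠ a in 𝓝[>] (0 : ℝ), ∀ i, a * C < γ i := by
    refine eventually_all.2 fun i => nhdsWithin_le_nhds ?_
    exact (continuous_id.mul_const C).continuousAt.eventually_lt (g := fun _ => γ i)
      continuousAt_const (by simpa using hγ i)
  filter_upwards [Ioo_mem_nhdsGT ha₀, Ioo_mem_nhdsGT one_pos, hsmall] with a ha ha1 hag
  have ha0 := ha.1
  have hpt : ∀ᵐ t ∂P.leb, ‖deriv (fun t => xb t + a • h t) t - P.f t (xb t + a • h t) (ub t)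
        - ∑ i, (a * β i) • (P.f t (xb t + a • h t) (w i t)
          - P.f t (xb t + a • h t) (ub t))‖ₑ
      ≤ ENNReal.ofReal (1 + B) * ‖P.remainder (D t) t (xb t) (ub t) a (h t) 0‖ₑ
        + ENNReal.ofReal (a ^ 2 * N t) := by
    filter_upwards [hode, hfeas.dynamics, ae_all_iff.2 hlip, ae_restrict_mem measurableSet_Icc,
      hfeas.arc.ae_differentiableAt_Icc P.T_pos.le] with t h1 h2 h3 h4 h5
    have h6 : deriv (fun t => xb t + a • h t) t = P.f t (xb t) (ub t) + a • (P.linDyn xb ub t (h t)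
      + ∑ i, β i • (P.f t (xb t) (w i t) - P.f t (xb t) (ub t))) := by
      have h7 := (h5.hasDerivAt.add (h1.const_smul a)).deriv
      rw [h2] at h7
      exact h7
    rw [h6, ← ofReal_norm, ← ofReal_norm, ← ENNReal.ofReal_mul (by positivity),
      ← ENNReal.ofReal_add (by positivity) (mul_nonneg (sq_nonneg a) (hN0 t))]
    refine ENNReal.ofReal_le_ofReal ?_
    have hah : ‖a • h t‖ ≤ a * C := by
      rw [norm_smul, Real.norm_of_nonneg ha0.le]; exact mul_le_mul_of_nonneg_left (hC t h4) ha0.le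
    refine norm_defect_le (D := D t (h t, 0) (h t, 0)) (κ := fun i => |κ i t|) ha0 ha1.2.le
      ?_ (fun i => ?_) ((P.linDyn xb ub t).le_opNorm_of_le (hC t h4)) ?_
    · simp [remainder, linDyn]
    · have h7 := (h3 i).2 (xb t + a • h t) (by
        rw [mem_ball_iff_norm, add_sub_cancel_left]; exact hah.trans_lt (hag i))
        (xb t) (Metric.mem_ball_self (hγ i))
      rw [add_sub_cancel_left] at h7
      calc _ ≤ κ i t * ‖a • h t‖ := h7
        _ ≤ |κ i t| * (a * C) := by gcongr; exact le_abs_self _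
        _ = _ := by ring
    · have h8 : ‖((h t, 0) : Euc n × Euc m)‖ ≤ C := by
        rw [Prod.norm_def]; simpa using hC t h4
      calc _ ≤ ‖D t‖ * ‖((h t, 0) : Euc n × Euc m)‖ * ‖((h t, 0) : Euc n × Euc m)‖ :=
            (D t).le_opNorm₂ _ _
        _ ≤ ‖D t‖ * C * C := by gcongr
        _ = _ := by ring
  refine (lintegral_mono_ae hpt).trans ?_
  rw [lintegral_add_right' _ ((hNi.const_mul (a ^ 2)).aestronglyMeasurable.aemeasurable.ennreal_ofReal),
    lintegral_const_mul' _ _ ENNReal.ofReal_ne_top,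
    ← ofReal_integral_eq_lintegral_ofReal (hNi.const_mul (a ^ 2))
      (Eventually.of_forall fun t => mul_nonneg (sq_nonneg a) (hN0 t)), integral_const_mul]
  calc _ ≤ ENNReal.ofReal (1 + B) * ENNReal.ofReal (1 * a ^ 2)
        + ENNReal.ofReal (a ^ 2 * ∫ t, N t ∂P.leb) := by gcongr; exact hrem a ha
    _ = _ := by
      rw [← ENNReal.ofReal_mul (by positivity), ← ENNReal.ofReal_add (by positivity)
        (mul_nonneg (sq_nonneg a) (integral_nonneg hN0))]
      congr 1; ring

/-- The linearization of a local minimum of the reduced functional: the directional derivative is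
nonnegative along the solutions of the linearized equation. -/
theorem linearized_nonneg {k : ℕ} {xb h : ℝ → Euc n} {ub : ℝ → Euc m} {w : Fin k → ℝ → Euc m}
    {β : Fin k → ℝ} {c δ : ℝ} (hfeas : P.IsFeasible xb ub) (hend : P.EndpointRegular xb)
    (hdyn : P.DynamicsRegular xb ub) (hstate : P.StateRegular xb)
    (hw : ∀ i, P.GoodControl xb (w i)) (hc : 0 < c) (hmin : P.IsLocalMinReduced c δ xb ub w)
    (hβ : ∀ i, 0 ≤ β i) (hh : P.IsArc h)
    (hode : ∀ᵐ t ∂P.leb, HasDerivAt h (P.linDyn xb ub t (h t)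
      + ∑ i, β i • (P.f t (xb t) (w i t) - P.f t (xb t) (ub t))) t)
    (hint : Integrable (fun t => P.linDyn xb ub t (h t)
      + ∑ i, β i • (P.f t (xb t) (w i t) - P.f t (xb t) (ub t))) P.leb) {M : ℝ}
    (hM0 : fderiv ℝ (P.ell 0) (P.ends xb) (P.ends h) < M)
    (hMj : ∀ j : Fin (r + 1), 1 ≤ j.val → j.val ≤ l → P.ell j (P.ends xb) = 0 →
      fderiv ℝ (P.ell j) (P.ends xb) (P.ends h) < M)
    (hMi : ∀ i, ∀ t ∈ P.active xb i, fderiv ℝ (P.g i t) (xb t) (h t) < M) :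
    0 ≤ c * M + ∑ j : Fin (r + 1) with l < j.val,
      |fderiv ℝ (P.ell j) (P.ends xb) (P.ends h)| := by
  by_contra! hneg
  obtain ⟨hZ, η, hη, hmin⟩ := hmin
  set J : Finset (Fin (r + 1)) := Finset.univ.filter fun j => l < j.val
  set S := c * M + ∑ j ∈ J, |fderiv ℝ (P.ell j) (P.ends xb) (P.ends h)| with hS
  set ε := -S / (2 * (J.card + 1)) with hε
  have hε0 : 0 < ε := div_pos (by linarith) (by positivity)
  set F : ℝ → Euc n := fun t => P.linDyn xb ub t (h t)
      + ∑ i, β i • (P.f t (xb t) (w i t) - P.f t (xb t) (ub t)) with hF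
  have hhc : ContinuousOn h (Icc 0 P.T) := by
    simpa [uIcc_of_le P.T_pos.le] using hh.continuousOn
  obtain ⟨K, hK⟩ := P.eventually_lintegral_defect_le hfeas hdyn hw hh hode
  have hpsi := P.eventually_psi_le hfeas hend hstate hhc hM0 hMj hMi
  have heq : ∀ᶠ a in 𝓝[>] (0 : ℝ), ∀ j ∈ J, |P.ell j (P.ends fun t => xb t + a • h t)|
      ≤ a * (|fderiv ℝ (P.ell j) (P.ends xb) (P.ends h)| + ε) := by
    refine (Finset.eventually_all J).2 fun j hj => ?_
    refine (P.hasDerivAt_ell hend h j).eventually_abs_le_mul ?_ hε0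
    simpa using hfeas.endpoint_eq j (by simpa [J] using hj)
  set B := ∑ i, β i with hB
  have hβB : ∀ i, β i ≤ B := fun i =>
    Finset.single_le_sum (fun i _ => hβ i) (Finset.mem_univ i)
  set Nn : ℝ≥0∞ := ‖h 0‖ₑ + eLpNorm F 1 P.leb with hNn
  have hNfin : Nn ≠ ⊤ :=
    ENNReal.add_ne_top.2 ⟨enorm_ne_top, (memLp_one_iff_integrable.2 hint).eLpNorm_ne_top⟩
  have hsmall : ∀ {u v : ℝ}, 0 < v → ∀ᶠ a in 𝓝[>] (0 : ℝ), a * u < v := fun {u v} hv =>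
    nhdsWithin_le_nhds ((continuous_id.mul_const u).continuousAt.eventually_lt
      (g := fun _ => v) continuousAt_const (by simpa using hv))
  obtain ⟨a, haK, hapsi, haeq, haB, haη, haN, haS, ha0⟩ := (hK.and (hpsi.and (heq.and
    ((hsmall (u := B) one_pos).and ((hsmall (u := B) hη).and ((hsmall (u := Nn.toReal) hη).and
      ((hsmall (u := K) (v := -S / 2) (by linarith)).and self_mem_nhdsWithin))))))).exists
  replace ha0 : 0 < a := ha0
  have hxarc : P.IsArc fun t => xb t + a • h t := hfeas.arc.add (hh.const_smul a)
  have hZ' : P.InZ δ ub w (fun t => xb t + a • h t) ub fun i => a * β i :=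
    ⟨hxarc, hZ.meas, hZ.mem, fun i => mul_nonneg ha0.le (hβ i), by
      rw [← Finset.mul_sum]; exact haB.le⟩
  have hdiff : (fun t => deriv (fun t => xb t + a • h t) t - deriv xb t) =ᵐ[P.leb] a • F := by
    filter_upwards [hode, hfeas.arc.ae_differentiableAt_Icc P.T_pos.le] with t h1 h2
    have h3 := (h2.hasDerivAt.add (h1.const_smul a)).deriv
    have h4 : deriv (fun t => xb t + a • h t) t = deriv xb t + a • F t := h3
    rw [h4]; simp
  have hle := hmin (fun t => xb t + a • h t) ub (fun i => a * β i) hZ' (by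
      rw [eLpNorm_congr_ae hdiff, eLpNorm_const_smul]
      simp only [add_sub_cancel_left, enorm_smul]
      rw [← mul_add, Real.enorm_of_nonneg ha0.le, ← hNn, ← ENNReal.ofReal_toReal hNfin,
        ← ENNReal.ofReal_mul ha0.le]
      exact (ENNReal.ofReal_lt_ofReal_iff hη).2 haN)
    (by simp_rw [sub_self]; rw [eLpNorm_zero']; exact ENNReal.ofReal_pos.2 hη)
    (fun i => by
      rw [abs_of_nonneg (mul_nonneg ha0.le (hβ i))]
      exact lt_of_le_of_lt (mul_le_mul_of_nonneg_left (hβB i) ha0.le) haη)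
  have h0 : (0 : EReal) ≤ P.reduced c xb w xb ub 0 := by
    refine add_nonneg ?_ (EReal.coe_ennreal_nonneg _)
    rw [EReal.coe_nonneg]
    exact add_nonneg (mul_nonneg hc.le (P.psi_self_nonneg hfeas))
      (Finset.sum_nonneg fun j _ => abs_nonneg _)
  have h1 : P.reduced c xb w (fun t => xb t + a • h t) ub (fun i => a * β i)
      ≤ ((c * (a * M) + ∑ j ∈ J, a * (|fderiv ℝ (P.ell j) (P.ends xb) (P.ends h)| + ε)
        + max (K * a ^ 2) 0 : ℝ) : EReal) := by
    rw [EReal.coe_add]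
    refine add_le_add ?_ ?_
    · rw [EReal.coe_le_coe_iff]
      exact add_le_add (mul_le_mul_of_nonneg_left hapsi hc.le) (Finset.sum_le_sum haeq)
    · rw [← EReal.coe_ennreal_ofReal]
      exact EReal.coe_ennreal_le_coe_ennreal_iff.2 haK
  have h2 := EReal.coe_nonneg.1 (h0.trans (hle.trans h1))
  have h3 : c * (a * M) + ∑ j ∈ J, a * (|fderiv ℝ (P.ell j) (P.ends xb) (P.ends h)| + ε)
      = a * (S + J.card * ε) := by
    rw [← Finset.mul_sum, Finset.sum_add_distrib, Finset.sum_const, nsmul_eq_mul, hS]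
    ring
  have h4 : J.card * ε ≤ (J.card + 1) * ε := by nlinarith
  have h5 : (J.card + 1) * ε = -S / 2 := by rw [hε]; field_simp
  rw [h3] at h2
  have h6 : a * (S + J.card * ε) ≤ a * (S / 2) := mul_le_mul_of_nonneg_left (by linarith) ha0.le
  have h7 : max (K * a ^ 2) 0 < a * (-S / 2) := by
    refine max_lt ?_ (mul_pos ha0 (by linarith))
    nlinarith
  linarith

end ControlProblem

namespace ControlProblem

variable {n m l r s : ℕ} (P : ControlProblem n m l r s)

theorem inner_gx (i : Fin s) (t : ℝ) (x v : Euc n) :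
    inner ℝ (P.gx i t x) v = fderiv ℝ (P.g i t) x v := by
  rw [gx, gradient, InnerProductSpace.toDual_symm_apply]

theorem hamx_ae_eq {xb : ℝ → Euc n} {ub : ℝ → Euc m} (hfeas : P.IsFeasible xb ub)
    (hdyn : P.DynamicsRegular xb ub) :
    ∀ᵐ t ∂P.leb, ∀ p : Euc n, P.hamx t (xb t) p (ub t)
      = ContinuousLinearMap.adjoint (P.linDyn xb ub t) p := by
  obtain ⟨δ, hδ, hreg⟩ := hdyn.regular
  filter_upwards [hreg, hfeas.selection.2] with t ht hu p
  have h1 : HasFDerivAt (P.fpair t) (fderiv ℝ (P.fpair t) (xb t, ub t)) (xb t, ub t) :=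
    (ht.2.2.2.1 (xb t, ub t) ⟨Metric.mem_ball_self hδ, Metric.mem_ball_self hδ, hu⟩).hasFDerivAt
  have h2 : HasFDerivAt (fun y => P.f t y (ub t)) (P.linDyn xb ub t) (xb t) :=
    HasFDerivAt.comp (g := P.fpair t) (f := fun y => (y, ub t)) (xb t) h1
      (hasFDerivAt_prodMk_left (xb t) (ub t))
  have h3 : HasFDerivAt (fun y => P.ham t y p (ub t))
      ((innerSL ℝ p).comp (P.linDyn xb ub t)) (xb t) :=
    (innerSL ℝ p).hasFDerivAt.comp (xb t) h2
  refine HasGradientAt.gradient (hasGradientAt_iff_hasFDerivAt.2 ?_)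
  have h4 : InnerProductSpace.toDual ℝ (Euc n)
      (ContinuousLinearMap.adjoint (P.linDyn xb ub t) p)
      = (innerSL ℝ p).comp (P.linDyn xb ub t) :=
    ContinuousLinearMap.ext fun v => by
      rw [InnerProductSpace.toDual_apply_apply, ContinuousLinearMap.adjoint_inner_left]
      rfl
  rw [h4]
  exact h3

theorem integrable_goodControl {xb : ℝ → Euc n} {ub : ℝ → Euc m} {u : ℝ → Euc m}
    (hfeas : P.IsFeasible xb ub) (hmeas : P.SuperpositionMeasurable xb)
    (hu : P.GoodControl xb u) : Integrable (fun t => P.f t (xb t) (u t)) P.leb := by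
  obtain ⟨ρ, hρ, hmeas⟩ := hmeas
  obtain ⟨hsel, γ, hγ, κ, hκ, hb⟩ := hu
  exact hκ.mono' (hmeas xb hfeas.arc (fun t _ => by simpa using hρ) u hsel)
    (hb.mono fun t ht => ht.1)

theorem isCompact_active {xb : ℝ → Euc n} (hstate : P.StateRegular xb)
    (hxb : ContinuousOn xb (Icc 0 P.T)) (i : Fin s) : IsCompact (P.active xb i) := by
  have hc : ContinuousOn (fun t => P.g i t (xb t)) (Icc 0 P.T) :=
    (hstate.cont i).comp (continuousOn_id.prodMk hxb) fun t ht => ⟨ht, mem_univ _⟩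
  refine isCompact_Icc.of_isClosed_subset ?_ (fun t ht => ht.1)
  exact hc.preimage_isClosed_of_isClosed isClosed_Icc isClosed_singleton

end ControlProblem

section Atomic

variable {κ : Type*} [Fintype κ]

/-- The measure with masses `ν a` at the points `τ a`. -/
def atomicMeasure (τ : κ → ℝ) (ν : κ → ℝ) : Measure ℝ :=
  ∑ a, ENNReal.ofReal (ν a) • Measure.dirac (τ a)

variable {τ : κ → ℝ} {ν : κ → ℝ}

instance : IsFiniteMeasure (atomicMeasure τ ν) := by
  refine ⟨?_⟩
  simp [atomicMeasure, Measure.finsetSum_apply]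

theorem setIntegral_atomicMeasure {E : Type*} [NormedAddCommGroup E] [NormedSpace ℝ E]
    [CompleteSpace E] (hν : ∀ a, 0 ≤ ν a) {S : Set ℝ} [DecidablePred (· ∈ S)]
    (hS : MeasurableSet S) (F : ℝ → E) :
    ∫ t in S, F t ∂atomicMeasure τ ν = ∑ a, if τ a ∈ S then ν a • F (τ a) else 0 := by
  classical
  rw [← integral_indicator hS, atomicMeasure, integral_finsetSum_measure]
  · refine Finset.sum_congr rfl fun a _ => ?_
    rw [integral_smul_measure, integral_dirac, ENNReal.toReal_ofReal (hν a)]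
    by_cases h : τ a ∈ S <;> simp [h]
  · intro a _
    refine Integrable.smul_measure ?_ ENNReal.ofReal_ne_top
    exact integrable_dirac (by simp)

theorem atomicMeasure_real (hν : ∀ a, 0 ≤ ν a) {S : Set ℝ} [DecidablePred (· ∈ S)]
    (hS : MeasurableSet S) :
    (atomicMeasure τ ν).real S = ∑ a, if τ a ∈ S then ν a else 0 := by
  have := setIntegral_atomicMeasure (τ := τ) hν hS fun _ => (1 : ℝ)
  simpa using this

theorem atomicMeasure_compl {S : Set ℝ} (hν : ∀ a, ν a ≠ 0 → τ a ∈ S) :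
    atomicMeasure τ ν Sᶜ = 0 := by
  classical
  simp only [atomicMeasure, Measure.finsetSum_apply, Finset.sum_eq_zero_iff, Measure.smul_apply,
    smul_eq_mul]
  intro a _
  by_cases h : ν a = 0
  · simp [h]
  · simp [hν a h]

end Atomic

namespace ControlProblem

variable {n m l r s : ℕ} (P : ControlProblem n m l r s)

/-- The inhomogeneities of the linearized equation: none for the directions of the initial state,
`f(t,xb,w_i) - f(t,xb,ub)` for the directions of the parameters `α_i`. -/
def forcing {k : ℕ} (xb : ℝ → Euc n) (ub : ℝ → Euc m) (w : Fin k → ℝ → Euc m) :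
    Fin n ⊕ Fin k → ℝ → Euc n :=
  Sum.elim (fun _ _ => 0) fun i t => P.f t (xb t) (w i t) - P.f t (xb t) (ub t)

/-- The initial states of the basis of solutions of the linearized equation. -/
def initial {n k : ℕ} : Fin n ⊕ Fin k → Euc n :=
  Sum.elim (fun i => EuclideanSpace.single i 1) fun _ => 0

/-- A basis of solutions of the linearized equation. -/
theorem exists_linearized_basis {k : ℕ} {xb : ℝ → Euc n} {ub : ℝ → Euc m} {w : Fin k → ℝ → Euc m}
    (hfeas : P.IsFeasible xb ub) (hmeas : P.SuperpositionMeasurable xb)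
    (hdyn : P.DynamicsRegular xb ub) (hw : ∀ i, P.GoodControl xb (w i)) :
    (∀ e, Integrable (P.forcing xb ub w e) P.leb) ∧
    ∃ h : Fin n ⊕ Fin k → ℝ → Euc n, ∀ e, ContinuousOn (h e) (Icc 0 P.T) ∧ h e 0 = initial e ∧
      ∀ t ∈ Icc 0 P.T, h e t = h e 0
        + ∫ s in (0 : ℝ)..t, (P.linDyn xb ub s (h e s) + P.forcing xb ub w e s) := by
  have hT := P.T_pos.le
  have hb : ∀ e, Integrable (P.forcing xb ub w e) P.leb := by
    rintro (i | i)
    · exact integrable_zero _ _ _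
    · exact (P.integrable_goodControl hfeas hmeas (hw i)).sub hdyn.summable_f
  have key : ∀ e, ∃ h : ℝ → Euc n, ContinuousOn h (Icc 0 P.T) ∧ h 0 = initial e ∧
      ∀ t ∈ Icc 0 P.T, h t = h 0
        + ∫ s in (0 : ℝ)..t, (P.linDyn xb ub s (h s) + P.forcing xb ub w e s) := fun e => by
    obtain ⟨h, hc, hh⟩ := exists_linear_ode hT
      ((intervalIntegrable_iff_integrableOn_Icc_of_le hT).2 (P.integrable_linDyn hdyn))
      ((intervalIntegrable_iff_integrableOn_Icc_of_le hT).2 (hb e)) (initial e)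
    have h0 : h 0 = initial e := by rw [hh 0 ⟨le_rfl, hT⟩]; simp
    exact ⟨h, hc, h0, fun t ht => h0 ▸ hh t ht⟩
  choose h hh using key
  exact ⟨hb, h, hh⟩

theorem linearized_nonneg_sum {k : ℕ} {xb : ℝ → Euc n} {ub : ℝ → Euc m}
    {w : Fin k → ℝ → Euc m} {c δ : ℝ} (hfeas : P.IsFeasible xb ub)
    (hend : P.EndpointRegular xb) (hdyn : P.DynamicsRegular xb ub) (hstate : P.StateRegular xb)
    (hw : ∀ i, P.GoodControl xb (w i)) (hc : 0 < c) (hmin : P.IsLocalMinReduced c δ xb ub w)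
    (hb : ∀ e, Integrable (P.forcing xb ub w e) P.leb) {h : Fin n ⊕ Fin k → ℝ → Euc n}
    (hhc : ∀ e, ContinuousOn (h e) (Icc 0 P.T))
    (hh : ∀ e, ∀ t ∈ Icc 0 P.T, h e t = h e 0
        + ∫ s in (0 : ℝ)..t, (P.linDyn xb ub s (h e s) + P.forcing xb ub w e s))
    {v : Fin n ⊕ Fin k → ℝ} (hv : ∀ i, 0 ≤ v (Sum.inr i)) {M : ℝ}
    (hM0 : ∑ e, fderiv ℝ (P.ell 0) (P.ends xb) (P.ends (h e)) * v e < M)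
    (hMj : ∀ j : Fin (r + 1), 1 ≤ j.val → j.val ≤ l → P.ell j (P.ends xb) = 0 →
      ∑ e, fderiv ℝ (P.ell j) (P.ends xb) (P.ends (h e)) * v e < M)
    (hMi : ∀ i, ∀ t ∈ P.active xb i, ∑ e, fderiv ℝ (P.g i t) (xb t) (h e t) * v e < M) :
    0 ≤ c * M + ∑ j : Fin (r + 1) with l < j.val,
      |∑ e, fderiv ℝ (P.ell j) (P.ends xb) (P.ends (h e)) * v e| := by
  have hT := P.T_pos.le
  set y : ℝ → Euc n := fun t => ∑ e, v e • h e t with hy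
  have hF : ∀ t, P.linDyn xb ub t (y t)
      + ∑ i, v (Sum.inr i) • (P.f t (xb t) (w i t) - P.f t (xb t) (ub t))
      = ∑ e, v e • (P.linDyn xb ub t (h e t) + P.forcing xb ub w e t) := fun t => by
    simp [hy, forcing, map_sum, smul_add, Finset.sum_add_distrib, add_assoc]
  have hFe : ∀ e, Integrable (fun t => P.linDyn xb ub t (h e t) + P.forcing xb ub w e t) P.leb :=
    fun e => by
      refine Integrable.add ?_ (hb e)
      have := ((intervalIntegrable_iff_integrableOn_Icc_of_le hT).2
        (P.integrable_linDyn hdyn)).clm_apply_continuousOn (h := h e)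
        (by rw [uIcc_of_le hT]; exact hhc e)
      exact (intervalIntegrable_iff_integrableOn_Icc_of_le hT).1 this
  have hint : Integrable (fun t => P.linDyn xb ub t (y t)
      + ∑ i, v (Sum.inr i) • (P.f t (xb t) (w i t) - P.f t (xb t) (ub t))) P.leb := by
    simp_rw [hF]
    exact integrable_finsetSum _ fun e _ => (hFe e).smul (v e)
  have hyi : ∀ t ∈ Icc 0 P.T, y t = y 0 + ∫ τ in (0 : ℝ)..t, (P.linDyn xb ub τ (y τ)
      + ∑ i, v (Sum.inr i) • (P.f τ (xb τ) (w i τ) - P.f τ (xb τ) (ub τ))) := by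
    intro t ht
    simp_rw [hF]
    rw [intervalIntegral.integral_finsetSum, ← Finset.sum_add_distrib]
    · refine Finset.sum_congr rfl fun e _ => ?_
      rw [intervalIntegral.integral_smul, ← smul_add, ← hh e t ht]
    · intro e _
      refine IntervalIntegrable.smul ?_ (v e)
      rw [intervalIntegrable_iff_integrableOn_Icc_of_le ht.1]
      exact (hFe e).mono_measure (Measure.restrict_mono (Icc_subset_Icc_right ht.2) le_rfl)
  have hii := (intervalIntegrable_iff_integrableOn_Icc_of_le hT).2 hint
  have hends : P.ends y = ∑ e, v e • P.ends (h e) := by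
    ext1
    · simp [ends, hy, Prod.fst_sum]
    · simp [ends, hy, Prod.snd_sum]
  have hell : ∀ j, fderiv ℝ (P.ell j) (P.ends xb) (P.ends y)
      = ∑ e, fderiv ℝ (P.ell j) (P.ends xb) (P.ends (h e)) * v e := fun j => by
    rw [hends, map_sum]
    exact Finset.sum_congr rfl fun e _ => by rw [map_smul, smul_eq_mul, mul_comm]
  have hg : ∀ i t, fderiv ℝ (P.g i t) (xb t) (y t)
      = ∑ e, fderiv ℝ (P.g i t) (xb t) (h e t) * v e := fun i t => by
    rw [hy, map_sum]
    exact Finset.sum_congr rfl fun e _ => by rw [map_smul, smul_eq_mul, mul_comm]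
  simp_rw [← hell] at hM0 hMj ⊢
  simp_rw [← hg] at hMi
  exact P.linearized_nonneg hfeas hend hdyn hstate hw hc hmin hv
    (absolutelyContinuousOnInterval_of_eq_integral hT hii hyi)
    (ae_hasDerivAt_of_eq_integral hT hii hyi) hint hM0 hMj hMi

end ControlProblem

end

theorem proposition5p5 {n m l r s k : ℕ} (P : ControlProblem n m l r s)
    (xb : ℝ → Euc n) (ub : ℝ → Euc m)
    (hfeas : P.IsFeasible xb ub)
    (hmeas : P.SuperpositionMeasurable xb)
    (hend : P.EndpointRegular xb) (hdyn : P.DynamicsRegular xb ub) (hstate : P.StateRegular xb)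
    (w : Fin k → ℝ → Euc m) (hw : ∀ i, P.GoodControl xb (w i))
    (c δ : ℝ) (hc : 0 < c) (hδ : 0 < δ)
    (hmin : P.IsLocalMinReduced c δ xb ub w) :
    ∃ (lam : Fin (r + 1) → ℝ) (μ : Fin s → Measure ℝ) (p : ℝ → Euc n),
      P.IsMultiplier xb ub w lam μ p := by
  classical
  have hT := P.T_pos.le
  have hxb : ContinuousOn xb (Icc 0 P.T) := by
    simpa [uIcc_of_le hT] using hfeas.arc.continuousOn
  obtain ⟨hb, h, hh⟩ := P.exists_linearized_basis hfeas hmeas hdyn hw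
  obtain ⟨κ, _, τ, ν, la, la', hν0, hντ, hτ, hla0, hlaJ, hsum, hpos, hzero⟩ :=
    exists_finite_multipliers (S := range Sum.inr) hc
      (fun j e => fderiv ℝ (P.ell j) (P.ends xb) (P.ends (h e)))
      (fun i t e => fderiv ℝ (P.g i t) (xb t) (h e t)) (Δ := P.active xb)
      (P.isCompact_active hstate hxb)
      (fun i => continuousOn_pi.2 fun e => by
        have h1 : ContinuousOn (fun t => fderiv ℝ (P.g i t) (xb t)) (Icc 0 P.T) :=
          (hstate.cont_deriv i).comp (continuousOn_id.prodMk hxb) fun t ht => ⟨ht, mem_univ _⟩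
        exact (h1.clm_apply (hh e).1).mono fun t ht => ht.1)
      (J₁ := {j | j = 0 ∨ 1 ≤ j.val ∧ j.val ≤ l ∧ P.ell j (P.ends xb) = 0}) ⟨0, Or.inl rfl⟩
      (Finset.univ.filter fun j => l < j.val)
      (fun v hv M hMj hMi => P.linearized_nonneg_sum hfeas hend hdyn hstate hw hc hmin hb
        (fun e => (hh e).1) (fun e => (hh e).2.2) (fun i => hv _ ⟨i, rfl⟩)
        (hMj 0 (Or.inl rfl)) (fun j h1 h2 h3 => hMj j (Or.inr ⟨h1, h2, h3⟩)) hMi)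
  have hτm : ∀ a, τ a ∈ Icc 0 P.T := fun a => by
    rcases hτ a with h0 | ⟨i, hi⟩
    · rw [h0]; exact ⟨le_rfl, hT⟩
    · exact hi.1
  have hlaJ' : ∀ j : Fin (r + 1), l < j.val → la j = 0 := fun j hj => hlaJ j (by
    rintro (rfl | h1)
    · simp at hj
    · omega)
  set lam : Fin (r + 1) → ℝ := fun j => la j + if l < j.val then la' j else 0 with hlam
  have hlam_le : ∀ j : Fin (r + 1), j.val ≤ l → lam j = la j := fun j hj => by
    simp [hlam, not_lt.2 hj]
  set Λ : Euc n × Euc n →L[ℝ] ℝ := ∑ j, lam j • fderiv ℝ (P.ell j) (P.ends xb) with hΛ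
  have hΛa : ∀ z, Λ z = ∑ j, lam j * fderiv ℝ (P.ell j) (P.ends xb) z := fun z => by
    simp [hΛ]
  set qT : Euc n := -(InnerProductSpace.toDual ℝ (Euc n)).symm
    (Λ.comp (ContinuousLinearMap.inr ℝ (Euc n) (Euc n))) with hqT
  have hqTi : ∀ v, inner ℝ qT v = -Λ (0, v) := fun v => by
    rw [hqT, inner_neg_left, InnerProductSpace.toDual_symm_apply]; rfl
  set G : κ → Euc n := fun a => ∑ i, ν a i • P.gx i (τ a) (xb (τ a)) with hG
  have hGi : ∀ a v, inner ℝ (G a) v = ∑ i, ν a i * fderiv ℝ (P.g i (τ a)) (xb (τ a)) v :=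
    fun a v => by simp [hG, sum_inner, inner_smul_left, P.inner_gx]
  obtain ⟨p, hbv, hlim, hadj, hdual⟩ :=
    exists_adjoint_arc P.T_pos (P.integrable_linDyn hdyn) τ hτm G qT
  have hmass : ∀ t ∈ Icc 0 P.T, ∑ i, ∫ σ in Icc t P.T, P.gx i σ (xb σ)
      ∂(atomicMeasure τ fun a => ν a i) = ∑ a, if t ≤ τ a then G a else 0 := by
    intro t ht
    have h1 : ∀ i, ∫ σ in Icc t P.T, P.gx i σ (xb σ) ∂(atomicMeasure τ fun a => ν a i)
        = ∑ a, if t ≤ τ a then ν a i • P.gx i (τ a) (xb (τ a)) else 0 := fun i => by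
      rw [setIntegral_atomicMeasure (fun a => hν0 a i) measurableSet_Icc]
      refine Finset.sum_congr rfl fun a _ => ?_
      simp only [mem_Icc, (hτm a).2, and_true]
    simp_rw [h1]
    rw [Finset.sum_comm]
    refine Finset.sum_congr rfl fun a _ => ?_
    split_ifs <;> simp [hG]
  have hmassT : ∑ i, (atomicMeasure τ fun a => ν a i).real {P.T} • P.gx i P.T (xb P.T)
      = ∑ a, if P.T ≤ τ a then G a else 0 := by
    rw [← hmass P.T ⟨hT, le_rfl⟩]
    refine Finset.sum_congr rfl fun i _ => ?_
    rw [Icc_self, integral_singleton]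
  have hqTeq : p P.T + ∑ i, (atomicMeasure τ fun a => ν a i).real {P.T} • P.gx i P.T (xb P.T)
      = qT := by
    rw [hmassT]
    have := hadj P.T ⟨hT, le_rfl⟩
    simpa using this
  have hd : ∀ e, ∑ j, la j * fderiv ℝ (P.ell j) (P.ends xb) (P.ends (h e))
      + ∑ j : Fin (r + 1) with l < j.val, la' j * fderiv ℝ (P.ell j) (P.ends xb) (P.ends (h e))
      + ∑ a, ∑ i, ν a i * fderiv ℝ (P.g i (τ a)) (xb (τ a)) (h e (τ a))
      = Λ (ControlProblem.initial e, 0) - inner ℝ (p 0) (ControlProblem.initial e)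
        - ∫ t in Icc 0 P.T, inner ℝ (p t) (P.forcing xb ub w e t) := by
    intro e
    have h1 := hdual (h e) (P.forcing xb ub w e) (hb e) (hh e).1 (hh e).2.2
    rw [hqTi, (hh e).2.1] at h1
    have h2 : Λ (P.ends (h e)) = Λ (ControlProblem.initial e, 0) + Λ (0, h e P.T) := by
      rw [← map_add, ← (hh e).2.1]; simp [ControlProblem.ends]
    have h3 : Λ (P.ends (h e)) = ∑ j, la j * fderiv ℝ (P.ell j) (P.ends xb) (P.ends (h e))
      + ∑ j : Fin (r + 1) with l < j.val,
        la' j * fderiv ℝ (P.ell j) (P.ends xb) (P.ends (h e)) := by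
      rw [hΛa, Finset.sum_filter, ← Finset.sum_add_distrib]
      refine Finset.sum_congr rfl fun j _ => ?_
      simp only [hlam]
      split_ifs <;> ring
    simp_rw [hGi] at h1
    rw [← h3]
    linarith
  have hp0 : ∀ v, inner ℝ (p 0) v = Λ (v, 0) := by
    have h1 : ∀ i : Fin n, inner ℝ (p 0) (EuclideanSpace.single i (1 : ℝ))
        = Λ (EuclideanSpace.single i 1, 0) := fun i => by
      have h2 := hzero (Sum.inl i) (by simp)
      rw [hd] at h2
      simp only [ControlProblem.initial, ControlProblem.forcing, Sum.elim_inl, inner_zero_right,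
        integral_zero, sub_zero] at h2
      linarith
    have h2 : (innerSL ℝ (p 0)) = Λ.comp (ContinuousLinearMap.inl ℝ (Euc n) (Euc n)) := by
      apply ContinuousLinearMap.coe_injective
      refine (EuclideanSpace.basisFun (Fin n) ℝ).toBasis.ext fun i => ?_
      simpa using h1 i
    intro v
    exact DFunLike.congr_fun h2 v
  refine ⟨lam, fun i => atomicMeasure τ fun a => ν a i, p, ?_⟩
  refine
    { finite := fun i => inferInstance
      supported := fun i => atomicMeasure_compl fun a => hντ a i
      bv := hbv
      nonneg := fun j hj => by rw [hlam_le j hj]; exact hla0 j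
      slack := fun j h1 h2 => ?_
      nontrivial := ?_
      integral_ineq := fun i => ?_
      left_limit := hlim
      adjoint := fun t ht => ?_
      transversality := fun h₀ h₁ => ?_ }
  · rw [hlam_le j h2]
    by_cases h3 : P.ell j (P.ends xb) = 0
    · rw [h3, mul_zero]
    · rw [hlaJ j, zero_mul]
      rintro (rfl | h4)
      · simp at h1
      · exact h3 h4.2.2
  · have h1 : ∑ j : Fin (r + 1) with j.val ≤ l, lam j = ∑ j, la j := by
      rw [Finset.sum_filter]
      refine Finset.sum_congr rfl fun j _ => ?_
      split_ifs with hj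
      · exact hlam_le j hj
      · exact (hlaJ' j (not_le.1 hj)).symm
    have h2 : ∑ i, (atomicMeasure τ fun a => ν a i).real (Icc 0 P.T) = ∑ a, ∑ i, ν a i := by
      rw [Finset.sum_comm]
      refine Finset.sum_congr rfl fun i _ => ?_
      rw [atomicMeasure_real (fun a => hν0 a i) measurableSet_Icc]
      exact Finset.sum_congr rfl fun a _ => if_pos (hτm a)
    have h3 : 0 ≤ ∑ j : Fin (r + 1) with l < j.val, |lam j| :=
      Finset.sum_nonneg fun j _ => abs_nonneg _
    rw [h1, h2]
    linarith
  · have h1 := hpos (Sum.inr i) ⟨i, rfl⟩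
    rw [hd] at h1
    simp only [ControlProblem.initial, ControlProblem.forcing, Sum.elim_inr, inner_zero_right,
      sub_zero, Prod.mk_zero_zero, map_zero, zero_sub] at h1
    rw [← integral_neg] at h1
    refine h1.trans (le_of_eq (integral_congr_ae (Eventually.of_forall fun t => ?_)))
    simp only
    rw [← inner_neg_right, neg_sub]
  · rw [hmass t ht, hqTeq, ← hadj t ht]
    congr 1
    refine integral_congr_ae ?_
    have h1 := ae_mono (Measure.restrict_mono (Icc_subset_Icc_left ht.1) le_rfl)
      (P.hamx_ae_eq hfeas hdyn)
    filter_upwards [h1] with σ hσ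
    exact hσ (p σ)
  · rw [hqTeq, hqTi, hp0, ← hΛa, sub_neg_eq_add, ← map_add]
    simp
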